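/- Let $d\ge 1$ be an integer, let $1<p<2$, and let $p'=p/(p-1)$. Let $\mathbb{T}^d=[-\pi,\pi]^d$ carry Lebesgue measure, and let $L^p(\mathbb{T}^d)$ be the usual space of complex-valued functions. Let $l^{p',p}(\mathbb{Z}^d)$ be the Lorentz sequence space of all $c=(c_m)_{m\in\mathbb{Z}^d}$, $c_m\in\mathbb{C}$, with $$\|c\|_{p',p}=\Big(\sum_{k=1}^{\infty}\big(k^{1/p'-1/p}\,c_k^*\big)^p\Big)^{1/p}<\infty,$$ where $c_k^*=\inf\{\tau\ge 0:\ \#\{m\in\mathbb{Z}^d:|c_m|>\tau\}\le k-1\}$ ($k\ge1$) is the non-increasing rearrangement of $c$. Then the discrete Fourier transform $$f\mapsto \Big(\int_{\mathbb{T}^d} f(t)\,e^{-i\langle t,m\rangle}\,dt\Big)_{m\in\mathbb{Z}^d}$$ is a bounded linear operator from $L^p(\mathbb{T}^d)$ into $l^{p',p}(\mathbb{Z}^d)$, but it is not strictly singular. Here a bounded linear operator $T:X\to Y$ is called strictly singular if for every infinite-dimensional closed subspace $E\subset X$ and every $\varepsilon>0$ there is $x\in E$ with $\|x\|_X=1$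 and $\|Tx\|_Y\le\varepsilon$. -/

import Mathlib

open MeasureTheory
open scoped ENNReal

noncomputable section

/-! ### Strict singularity -/

/-- A bounded linear operator `T : X → Y` is strictly singular if for every infinite-dimensional
closed subspace `E` of `X` and every `ε > 0` there is `x` in the unit sphere of `E` with
`‖T x‖ ≤ ε`. -/
def StrictlySingular {X Y : Type*} [NormedAddCommGroup X] [NormedSpace ℂ X]
    [NormedAddCommGroup Y] [NormedSpace ℂ Y] (T : X →L[ℂ] Y) : Prop :=
  ∀ E : Submodule ℂ X, IsClosed (E : Set X) → ¬ FiniteDimensional ℂ E →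
    ∀ ε : ℝ, 0 < ε → ∃ x ∈ E, ‖x‖ = 1 ∧ ‖T x‖ ≤ ε

/-! ### Lorentz sequence spaces -/

namespace Lorentz

variable {ι : Type*}

/-- The non-increasing rearrangement of a family `c`, indexed from `0`:
`rearr c k` is the usual `c*_{k+1} = inf {τ ≥ 0 | #{m | |c m| > τ} ≤ k}`
(an element of `[0, ∞]`; it is `∞` iff `c` is unbounded). -/
def rearr (c : ι → ℂ) (k : ℕ) : ℝ≥0∞ :=
  sInf {τ : ℝ≥0∞ | {m | τ < ‖c m‖ₑ}.encard ≤ k}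

/-- The weight `k ^ (1/r - 1/s)`, where `k` is shifted by one. -/
def weight (r s : ℝ) (k : ℕ) : ℝ≥0∞ := ((k : ℝ≥0∞) + 1) ^ (1 / r - 1 / s)

/-- The Lorentz functional `‖c‖_{r,s} = (∑_{k ≥ 1} (k ^ (1/r - 1/s) c*_k) ^ s) ^ (1/s)`,
with values in `[0, ∞]`. -/
def eNorm (r s : ℝ) (c : ι → ℂ) : ℝ≥0∞ :=
  (∑' k : ℕ, (weight r s k * rearr c k) ^ s) ^ (1 / s)

lemma rearr_antitone (c : ι → ℂ) : Antitone (rearr c) := by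
  intro k l hkl
  apply sInf_le_sInf
  intro τ hτ
  have hτ' : {m | τ < ‖c m‖ₑ}.encard ≤ (k : ℕ∞) := hτ
  exact hτ'.trans (by exact_mod_cast hkl)

lemma le_rearr_zero (c : ι → ℂ) (m : ι) : ‖c m‖ₑ ≤ rearr c 0 := by
  refine le_sInf fun τ hτ => ?_
  by_contra h
  have hτ' : {m | τ < ‖c m‖ₑ}.encard ≤ 0 := by simpa using hτ
  have h0 : {m | τ < ‖c m‖ₑ} = ∅ := by simpa using hτ'
  have : m ∈ {m | τ < ‖c m‖ₑ} := not_le.1 h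
  rw [h0] at this
  exact this

lemma rearr_zero_fun (k : ℕ) : rearr (0 : ι → ℂ) k = 0 := by
  refine le_antisymm (sInf_le ?_) bot_le
  simp

lemma rearr_zero_le {c : ι → ℂ} {M : ℝ≥0∞} (h : ∀ m, ‖c m‖ₑ ≤ M) : rearr c 0 ≤ M := by
  refine sInf_le ?_
  have : {m | M < ‖c m‖ₑ} = ∅ := by
    ext m; simpa using h m
  simp [this]

lemma rearr_smul_le (a : ℂ) (c : ι → ℂ) (k : ℕ) : rearr (a • c) k ≤ ‖a‖ₑ * rearr c k := by
  rcases eq_or_ne a 0 with rfl | ha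
  · simp [rearr_zero_fun]
  have ha0 : ‖a‖ₑ ≠ 0 := by simpa using ha
  have hat : ‖a‖ₑ ≠ ∞ := enorm_ne_top
  have key : ‖a‖ₑ⁻¹ * rearr (a • c) k ≤ rearr c k := by
    refine le_sInf fun τ hτ => ?_
    have h1 : rearr (a • c) k ≤ ‖a‖ₑ * τ := by
      refine sInf_le ?_
      refine le_trans (Set.encard_le_encard ?_) hτ
      intro m hm
      simp only [Set.mem_ofPred_eq, Pi.smul_apply, enorm_smul] at hm ⊢
      exact lt_of_mul_lt_mul_left' hm
    calc ‖a‖ₑ⁻¹ * rearr (a • c) k ≤ ‖a‖ₑ⁻¹ * (‖a‖ₑ * τ) := by gcongr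
      _ = τ := by rw [← mul_assoc, ENNReal.inv_mul_cancel ha0 hat, one_mul]
  calc rearr (a • c) k = ‖a‖ₑ * (‖a‖ₑ⁻¹ * rearr (a • c) k) := by
        rw [← mul_assoc, ENNReal.mul_inv_cancel ha0 hat, one_mul]
    _ ≤ _ := by gcongr

lemma weight_zero (r s : ℝ) : weight r s 0 = 1 := by simp [weight]

lemma weight_antitone {r s : ℝ} (hs : 1 ≤ s) (hr : s ≤ r) : Antitone (weight r s) := by
  intro k l hkl
  have hexp : 1 / r - 1 / s ≤ 0 := by
    have := one_div_le_one_div_of_le (by linarith : 0 < s) hr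
    linarith
  have hkl' : (k : ℝ≥0∞) + 1 ≤ (l : ℝ≥0∞) + 1 := by gcongr
  obtain ⟨t, ht⟩ : ∃ t, t = -(1 / r - 1 / s) := ⟨_, rfl⟩
  have ht' : 1 / r - 1 / s = -t := by linarith
  have ht0 : 0 ≤ t := by linarith
  simp only [weight, ht', ENNReal.rpow_neg]
  exact ENNReal.inv_le_inv.2 (ENNReal.rpow_le_rpow hkl' ht0)

lemma eNorm_smul_le {r s : ℝ} (hs : 1 ≤ s) (a : ℂ) (c : ι → ℂ) :
    eNorm r s (a • c) ≤ ‖a‖ₑ * eNorm r s c := by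
  have hs0 : 0 < s := by linarith
  have h1 : ∑' k : ℕ, (weight r s k * rearr (a • c) k) ^ s ≤
      ‖a‖ₑ ^ s * ∑' k : ℕ, (weight r s k * rearr c k) ^ s := by
    rw [← ENNReal.tsum_mul_left]
    refine ENNReal.tsum_le_tsum fun k => ?_
    rw [← ENNReal.mul_rpow_of_nonneg _ _ hs0.le]
    refine ENNReal.rpow_le_rpow ?_ hs0.le
    calc weight r s k * rearr (a • c) k ≤ weight r s k * (‖a‖ₑ * rearr c k) := by
          gcongr; exact rearr_smul_le a c k
      _ = _ := by ring
  calc eNorm r s (a • c) ≤ (‖a‖ₑ ^ s * ∑' k : ℕ, (weight r s k * rearr c k) ^ s) ^ (1 / s) :=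
        ENNReal.rpow_le_rpow h1 (by positivity)
    _ = _ := by
      rw [ENNReal.mul_rpow_of_nonneg _ _ (by positivity), ← ENNReal.rpow_mul,
        mul_one_div_cancel hs0.ne', ENNReal.rpow_one, eNorm]

lemma eNorm_smul {r s : ℝ} (hs : 1 ≤ s) (a : ℂ) (c : ι → ℂ) :
    eNorm r s (a • c) = ‖a‖ₑ * eNorm r s c := by
  refine le_antisymm (eNorm_smul_le hs a c) ?_
  rcases eq_or_ne a 0 with rfl | ha
  · simp
  have ha0 : ‖a‖ₑ ≠ 0 := by simpa using ha
  have hat : ‖a‖ₑ ≠ ∞ := enorm_ne_top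
  have h := eNorm_smul_le (r := r) hs a⁻¹ (a • c)
  rw [smul_smul, inv_mul_cancel₀ ha, one_smul, enorm_inv ha] at h
  calc ‖a‖ₑ * eNorm r s c ≤ ‖a‖ₑ * (‖a‖ₑ⁻¹ * eNorm r s (a • c)) := by gcongr
    _ = _ := by rw [← mul_assoc, ENNReal.mul_inv_cancel ha0 hat, one_mul]

lemma rearr_zero_le_eNorm {r s : ℝ} (hs : 1 ≤ s) (c : ι → ℂ) : rearr c 0 ≤ eNorm r s c := by
  have hs0 : 0 < s := by linarith
  have h := ENNReal.le_tsum (f := fun k : ℕ => (weight r s k * rearr c k) ^ s) 0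
  simp only [weight_zero, one_mul] at h
  calc rearr c 0 = (rearr c 0 ^ s) ^ (1 / s) := by
        rw [← ENNReal.rpow_mul, mul_one_div_cancel hs0.ne', ENNReal.rpow_one]
    _ ≤ _ := ENNReal.rpow_le_rpow h (by positivity)

lemma eNorm_zero {r s : ℝ} (hs : 1 ≤ s) : eNorm r s (0 : ι → ℂ) = 0 := by
  have hs0 : 0 < s := by linarith
  simp [eNorm, rearr_zero_fun, hs0]

lemma eq_zero_of_eNorm {r s : ℝ} (hs : 1 ≤ s) {c : ι → ℂ} (h : eNorm r s c = 0) : c = 0 := by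
  ext m
  have := (le_rearr_zero c m).trans (rearr_zero_le_eNorm (r := r) hs c)
  rw [h] at this
  simpa using this

/-- Summation by parts. -/
lemma sum_mul_le_of_partial (n : ℕ) : ∀ (w a b : ℕ → ℝ≥0∞), Antitone w →
    (∀ j, ∑ k ∈ Finset.range j, a k ≤ ∑ k ∈ Finset.range j, b k) →
    ∑ k ∈ Finset.range n, w k * a k ≤ ∑ k ∈ Finset.range n, w k * b k := by
  induction n with
  | zero => intro w a b _ _; simp
  | succ n ih =>
    intro w a b hw hab
    have key : ∀ x : ℕ → ℝ≥0∞, ∑ k ∈ Finset.range (n + 1), w k * x k =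
        ∑ k ∈ Finset.range n, (w k - w n) * x k + w n * ∑ k ∈ Finset.range (n + 1), x k := by
      intro x
      rw [Finset.sum_range_succ, Finset.sum_range_succ, mul_add, ← add_assoc, Finset.mul_sum,
        ← Finset.sum_add_distrib]
      congr 1
      refine Finset.sum_congr rfl fun k hk => ?_
      rw [← add_mul, tsub_add_cancel_of_le (hw (Finset.mem_range.1 hk).le)]
    rw [key a, key b]
    exact add_le_add (ih (fun k => w k - w n) a b (fun k l h => tsub_le_tsub_right (hw h) _) hab)
      (mul_le_mul_right (hab (n + 1)) _)

lemma sum_finset_le (c : ι → ℂ) {s : ℝ} (hs : 0 ≤ s) (j : ℕ) : ∀ A : Finset ι, A.card = j →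
    ∑ m ∈ A, ‖c m‖ₑ ^ s ≤ ∑ k ∈ Finset.range j, rearr c k ^ s := by
  classical
  induction j with
  | zero => intro A hA; simp [Finset.card_eq_zero.1 hA]
  | succ j ih =>
    intro A hA
    have hne : A.Nonempty := Finset.card_pos.1 (by omega)
    obtain ⟨m, hm, hmin⟩ := Finset.exists_min_image A (fun m => ‖c m‖ₑ) hne
    have h1 : ‖c m‖ₑ ≤ rearr c j := by
      refine le_sInf fun τ hτ => ?_
      by_contra hlt
      have hsub : (A : Set ι) ⊆ {m | τ < ‖c m‖ₑ} := fun x hx =>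
        lt_of_lt_of_le (not_le.1 hlt) (hmin x hx)
      have h2 := (Set.encard_le_encard hsub).trans hτ
      rw [Set.encard_coe_eq_coe_finsetCard, hA] at h2
      have : j + 1 ≤ j := by exact_mod_cast h2
      omega
    rw [← Finset.sum_erase_add A _ hm, Finset.sum_range_succ]
    exact add_le_add (ih _ (by rw [Finset.card_erase_of_mem hm, hA]; rfl))
      (ENNReal.rpow_le_rpow h1 hs)

lemma sum_inj_le {r s : ℝ} (hs : 1 ≤ s) (hr : s ≤ r) (c : ι → ℂ) (n : ℕ) (K : Finset ℕ)
    (hK : K ⊆ Finset.range n) (e : ℕ → ι) (he : Set.InjOn e K) :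
    (∑ k ∈ K, (weight r s k * ‖c (e k)‖ₑ) ^ s) ^ (1 / s) ≤ eNorm r s c := by
  classical
  have hs0 : 0 < s := by linarith
  refine ENNReal.rpow_le_rpow ?_ (by positivity)
  have hpart : ∀ j, ∑ k ∈ Finset.range j, (if k ∈ K then ‖c (e k)‖ₑ ^ s else 0) ≤
      ∑ k ∈ Finset.range j, rearr c k ^ s := by
    intro j
    rw [← Finset.sum_filter]
    have hinj : Set.InjOn e ((Finset.range j).filter (· ∈ K) : Finset ℕ) :=
      he.mono (fun k hk => by simpa using (Finset.mem_filter.1 hk).2)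
    rw [← Finset.sum_image (f := fun m => ‖c m‖ₑ ^ s) (g := e) hinj]
    refine (sum_finset_le c hs0.le _ _ rfl).trans ?_
    refine Finset.sum_le_sum_of_subset ?_
    refine Finset.range_mono ?_
    refine Finset.card_image_le.trans ((Finset.card_filter_le _ _).trans ?_)
    simp
  have hw : Antitone fun k => weight r s k ^ s := fun k l h =>
    ENNReal.rpow_le_rpow (weight_antitone hs hr h) hs0.le
  have h := sum_mul_le_of_partial n _ _ _ hw hpart
  calc ∑ k ∈ K, (weight r s k * ‖c (e k)‖ₑ) ^ s
      = ∑ k ∈ Finset.range n, weight r s k ^ s * (if k ∈ K then ‖c (e k)‖ₑ ^ s else 0) := by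
        simp only [mul_ite, mul_zero]
        rw [← Finset.sum_filter, Finset.filter_mem_eq_inter, Finset.inter_eq_right.2 hK]
        exact Finset.sum_congr rfl fun k _ => ENNReal.mul_rpow_of_nonneg _ _ hs0.le
    _ ≤ _ := h
    _ = ∑ k ∈ Finset.range n, (weight r s k * rearr c k) ^ s :=
        Finset.sum_congr rfl fun k _ => (ENNReal.mul_rpow_of_nonneg _ _ hs0.le).symm
    _ ≤ _ := ENNReal.sum_le_tsum _

lemma exists_inj [Nonempty ι] (f : ι → ℂ) (τ : ℕ → ℝ≥0∞) (n : ℕ) : ∃ e : ℕ → ι,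
    Set.InjOn e {k | k < n ∧ τ k < rearr f k} ∧
      ∀ k, k < n → τ k < rearr f k → τ k < ‖f (e k)‖ₑ := by
  classical
  induction n with
  | zero => exact ⟨fun _ => Classical.arbitrary ι, by simp [Set.InjOn], by simp⟩
  | succ n ih =>
    obtain ⟨e, he, hτ⟩ := ih
    by_cases hn : τ n < rearr f n
    · have hcard : (n : ℕ∞) < {m | τ n < ‖f m‖ₑ}.encard := by
        by_contra h
        have hle : rearr f n ≤ τ n := sInf_le (not_lt.1 h)
        exact absurd hle (not_le.2 hn)
      obtain ⟨m, hm, hme⟩ : ∃ m ∈ {m | τ n < ‖f m‖ₑ}, m ∉ (Finset.range n).image e := by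
        by_contra hcon
        push Not at hcon
        have hsub : {m | τ n < ‖f m‖ₑ} ⊆ (((Finset.range n).image e : Finset ι) : Set ι) :=
          fun m hm => hcon m hm
        have h1 := Set.encard_le_encard hsub
        rw [Set.encard_coe_eq_coe_finsetCard] at h1
        have h2 : (((Finset.range n).image e).card : ℕ∞) ≤ n := by
          exact_mod_cast Finset.card_image_le.trans (by simp)
        exact absurd (h1.trans h2) (not_le.2 hcard)
      have hme' : ∀ k < n, e k ≠ m := fun k hk h =>
        hme (Finset.mem_image.2 ⟨k, Finset.mem_range.2 hk, h⟩)
      refine ⟨Function.update e n m, ?_, ?_⟩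
      · rintro k ⟨hk, hk'⟩ l ⟨hl, hl'⟩ hkl
        rcases Nat.lt_succ_iff_lt_or_eq.1 hk with hk | rfl <;>
          rcases Nat.lt_succ_iff_lt_or_eq.1 hl with hl | rfl
        · rw [Function.update_of_ne hk.ne, Function.update_of_ne hl.ne] at hkl
          exact he ⟨hk, hk'⟩ ⟨hl, hl'⟩ hkl
        · rw [Function.update_of_ne hk.ne, Function.update_self] at hkl
          exact absurd hkl (hme' k hk)
        · rw [Function.update_of_ne hl.ne, Function.update_self] at hkl
          exact absurd hkl.symm (hme' l hl)
        · rfl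
      · intro k hk hk'
        rcases Nat.lt_succ_iff_lt_or_eq.1 hk with hk | rfl
        · rw [Function.update_of_ne hk.ne]; exact hτ k hk hk'
        · rw [Function.update_self]; exact hm
    · have hlt : ∀ k, k < n + 1 → τ k < rearr f k → k < n := fun k hk hk' => by
        rcases Nat.lt_succ_iff_lt_or_eq.1 hk with hk | rfl
        · exact hk
        · exact absurd hk' hn
      have hsub : {k | k < n + 1 ∧ τ k < rearr f k} ⊆ {k | k < n ∧ τ k < rearr f k} :=
        fun k hk => ⟨hlt k hk.1 hk.2, hk.2⟩
      exact ⟨e, he.mono hsub, fun k hk hk' => hτ k (hlt k hk hk') hk'⟩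

/-- For `1 ≤ s ≤ r` the Lorentz functional satisfies the triangle inequality. -/
lemma eNorm_add_le {r s : ℝ} (hs : 1 ≤ s) (hr : s ≤ r) (c d : ι → ℂ) :
    eNorm r s (c + d) ≤ eNorm r s c + eNorm r s d := by
  classical
  have hs0 : 0 < s := by linarith
  rcases isEmpty_or_nonempty ι with hι | hι
  · rw [Subsingleton.elim (c + d) 0, eNorm_zero hs]; exact bot_le
  by_cases htop : eNorm r s c + eNorm r s d = ∞
  · rw [htop]; exact le_top
  have hfin : ∀ k, rearr (c + d) k ≠ ∞ := by
    intro k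
    refine ne_top_of_le_ne_top htop ((rearr_antitone _ (Nat.zero_le k)).trans
      (rearr_zero_le fun m => ?_))
    refine (enorm_add_le (c m) (d m)).trans (add_le_add ?_ ?_)
    · exact (le_rearr_zero c m).trans (rearr_zero_le_eNorm hs c)
    · exact (le_rearr_zero d m).trans (rearr_zero_le_eNorm hs d)
  refine ENNReal.le_of_forall_lt_one_mul_le fun θ hθ => ?_
  set τ : ℕ → ℝ≥0∞ := fun k => θ * rearr (c + d) k with hτdef
  have hpart : ∀ n : ℕ, ∑ k ∈ Finset.range n, (weight r s k * τ k) ^ s ≤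
      (eNorm r s c + eNorm r s d) ^ s := by
    intro n
    obtain ⟨e, he, hτ⟩ := exists_inj (c + d) τ n
    set K : Finset ℕ := (Finset.range n).filter (fun k => τ k < rearr (c + d) k) with hK
    have hKn : K ⊆ Finset.range n := Finset.filter_subset _ _
    have heK : Set.InjOn e K := he.mono fun k hk => by simpa [hK] using hk
    have h1 : ∑ k ∈ Finset.range n, (weight r s k * τ k) ^ s =
        ∑ k ∈ K, (weight r s k * τ k) ^ s := by
      refine (Finset.sum_subset hKn fun k hk hkK => ?_).symm
      have h0 : rearr (c + d) k = 0 := by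
        by_contra hne
        refine hkK (Finset.mem_filter.2 ⟨hk, ?_⟩)
        calc τ k < 1 * rearr (c + d) k := ENNReal.mul_lt_mul_left hne (hfin k) hθ
          _ = _ := one_mul _
      simp [hτdef, h0, hs0]
    rw [h1]
    have h2 : ∑ k ∈ K, (weight r s k * τ k) ^ s ≤
        ∑ k ∈ K, (weight r s k * ‖c (e k)‖ₑ + weight r s k * ‖d (e k)‖ₑ) ^ s := by
      refine Finset.sum_le_sum fun k hk => ENNReal.rpow_le_rpow ?_ hs0.le
      rw [← mul_add]
      gcongr
      have hk' := Finset.mem_filter.1 hk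
      exact (hτ k (Finset.mem_range.1 hk'.1) hk'.2).le.trans (enorm_add_le _ _)
    have h3 := ENNReal.Lp_add_le K (fun k => weight r s k * ‖c (e k)‖ₑ)
      (fun k => weight r s k * ‖d (e k)‖ₑ) hs
    have h4 := h3.trans (add_le_add (sum_inj_le hs hr c n K hKn e heK)
      (sum_inj_le hs hr d n K hKn e heK))
    refine h2.trans ?_
    have h5 := ENNReal.rpow_le_rpow h4 hs0.le
    rwa [← ENNReal.rpow_mul, one_div_mul_cancel hs0.ne', ENNReal.rpow_one] at h5
  have hsum : ∑' k : ℕ, (weight r s k * τ k) ^ s ≤ (eNorm r s c + eNorm r s d) ^ s := by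
    rw [ENNReal.tsum_eq_iSup_nat]
    exact iSup_le hpart
  have heq : ∑' k : ℕ, (weight r s k * τ k) ^ s =
      θ ^ s * ∑' k : ℕ, (weight r s k * rearr (c + d) k) ^ s := by
    rw [← ENNReal.tsum_mul_left]
    congr 1
    ext k
    rw [← ENNReal.mul_rpow_of_nonneg _ _ hs0.le, hτdef]
    congr 1
    ring
  rw [heq] at hsum
  have h6 := ENNReal.rpow_le_rpow hsum (by positivity : 0 ≤ 1 / s)
  rwa [ENNReal.mul_rpow_of_nonneg _ _ (by positivity), ← ENNReal.rpow_mul, ← ENNReal.rpow_mul,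
    mul_one_div_cancel hs0.ne', ENNReal.rpow_one, ENNReal.rpow_one] at h6

/-- The families of finite Lorentz norm, as a linear subspace of all families. -/
def finiteNorm (ι : Type*) (r s : ℝ) [hs : Fact (1 ≤ s)] [hr : Fact (s ≤ r)] :
    Submodule ℂ (ι → ℂ) where
  carrier := {c | eNorm r s c < ∞}
  zero_mem' := by simp [eNorm_zero hs.out]
  add_mem' {c d} hc hd :=
    (eNorm_add_le hs.out hr.out c d).trans_lt (ENNReal.add_lt_top.2 ⟨hc, hd⟩)
  smul_mem' a c hc := by
    simp only [Set.mem_ofPred_eq, eNorm_smul hs.out]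
    exact ENNReal.mul_lt_top enorm_lt_top hc

end Lorentz

/-- The Lorentz sequence space `l^{r,s}(ι)`, `1 ≤ s ≤ r`: all `c : ι → ℂ` with
`‖c‖_{r,s} < ∞`, normed by `‖·‖_{r,s}`. -/
def LorentzSeq (ι : Type*) (r s : ℝ) [Fact (1 ≤ s)] [Fact (s ≤ r)] : Type _ :=
  Lorentz.finiteNorm ι r s

namespace LorentzSeq

variable {ι : Type*} {r s : ℝ} [hs : Fact (1 ≤ s)] [hr : Fact (s ≤ r)]

instance : AddCommGroup (LorentzSeq ι r s) :=
  inferInstanceAs (AddCommGroup (Lorentz.finiteNorm ι r s))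

instance : Module ℂ (LorentzSeq ι r s) :=
  inferInstanceAs (Module ℂ (Lorentz.finiteNorm ι r s))

instance : CoeFun (LorentzSeq ι r s) (fun _ => ι → ℂ) := ⟨fun c => c.1⟩

instance : Norm (LorentzSeq ι r s) := ⟨fun c => (Lorentz.eNorm r s (c : ι → ℂ)).toReal⟩

lemma core : NormedSpace.Core ℂ (LorentzSeq ι r s) where
  norm_nonneg _ := ENNReal.toReal_nonneg
  norm_smul a c := by
    change (Lorentz.eNorm r s (a • c.1)).toReal = ‖a‖ * (Lorentz.eNorm r s c.1).toReal
    rw [Lorentz.eNorm_smul hs.out, ENNReal.toReal_mul, toReal_enorm]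
  norm_triangle c d := by
    change (Lorentz.eNorm r s (c.1 + d.1)).toReal ≤
      (Lorentz.eNorm r s c.1).toReal + (Lorentz.eNorm r s d.1).toReal
    have hc : Lorentz.eNorm r s c.1 ≠ ∞ := ne_of_lt c.2
    have hd : Lorentz.eNorm r s d.1 ≠ ∞ := ne_of_lt d.2
    rw [← ENNReal.toReal_add hc hd]
    exact ENNReal.toReal_mono (ENNReal.add_ne_top.2 ⟨hc, hd⟩)
      (Lorentz.eNorm_add_le hs.out hr.out c.1 d.1)
  norm_eq_zero_iff c := by
    change (Lorentz.eNorm r s c.1).toReal = 0 ↔ c = 0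
    constructor
    · intro h
      rcases (ENNReal.toReal_eq_zero_iff _).1 h with h | h
      · exact Subtype.ext (Lorentz.eq_zero_of_eNorm hs.out h)
      · exact absurd h (ne_of_lt c.2)
    · rintro rfl
      change (Lorentz.eNorm r s (0 : ι → ℂ)).toReal = 0
      rw [Lorentz.eNorm_zero hs.out, ENNReal.toReal_zero]

instance : NormedAddCommGroup (LorentzSeq ι r s) := NormedAddCommGroup.ofCore core

instance : NormedSpace ℂ (LorentzSeq ι r s) := NormedSpace.ofCore core

end LorentzSeq

/-! ### The discrete Fourier transform -/

/-- The torus `𝕋^d = [-π, π]^d` with Lebesgue measure, as a measure on `ℝ^d`. -/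
def torusMeasure (d : ℕ) : Measure (Fin d → ℝ) :=
  volume.restrict (Set.Icc (fun _ => -Real.pi) (fun _ => Real.pi))

/-- The Fourier coefficient `∫_{𝕋^d} f(t) e^{-i⟨t,m⟩} dt`, `m ∈ ℤ^d`. -/
def torusFourierCoeff {d : ℕ} (f : (Fin d → ℝ) → ℂ) (m : Fin d → ℤ) : ℂ :=
  ∫ t, f t * Complex.exp (-Complex.I * ((∑ j, t j * (m j : ℝ) : ℝ) : ℂ)) ∂(torusMeasure d)

section Exponents

variable {p : ℝ} [h1 : Fact (1 < p)]

instance factOneLe : Fact (1 ≤ p) := ⟨h1.out.le⟩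

instance factOneLeOfReal : Fact (1 ≤ ENNReal.ofReal p) :=
  ⟨by simpa using ENNReal.ofReal_le_ofReal h1.out.le⟩

/-- For `1 < p < 2` one has `p ≤ p'`, where `p' = p / (p - 1)`. -/
instance factLeConjExponent [h2 : Fact (p < 2)] : Fact (p ≤ p.conjExponent) :=
  ⟨by
    have h1' := h1.out
    have h2' := h2.out
    rw [Real.conjExponent, le_div_iff₀ (by linarith)]
    nlinarith⟩

end Exponents

end

noncomputable section

/-! ### Bessel's inequality on the torus -/

/-! Boundedness is Paley's inequality. For distinct frequencies `e k`, the map `f ↦ ((k + 1) f̂(e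
k))_k` into functions on `ℕ` with masses `(k + 1)⁻²` is of weak type (1,1), since `|f̂| ≤ ‖f‖₁`, and
of weak type (2,2), by Bessel. Marcinkiewicz interpolation bounds `∑ (k + 1)^(p-2) |f̂(e k)|^p` by a
multiple of `‖f‖_p^p`, with a constant independent of `e`. Letting `e` follow the decreasing
rearrangement gives `eNorm_torusFourierCoeff_le`.

Strict singularity fails because both spaces contain `ℓ^p` and the transform carries one copy onto
another. Take indicators of disjoint slabs of measure `κ 2^{-j}`, with height `2^{j/p}`.
Disjointness gives the upper `p`-estimate `enorm_sum_bumpLp_rpow_le`. On the `2^j` lowest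
nonnegative frequencies of one coordinate axis the coefficients do not cancel, so the weighted `ℓ^p`
mass of the `j`-th transform stays bounded below (`le_tsum_bumpRow`). Each single coefficient tends
to zero, because the `L¹` norms do (`tendsto_bumpRow`). A gliding hump therefore selects a
subsequence whose weighted transforms live almost on disjoint blocks, which yields the lower
`p`-estimate `exists_lower_estimate`. The two estimates make the operator bounded below on the
closed span of the subsequence (`not_strictlySingular_of_estimates`). -/

instance isFiniteMeasure_torusMeasure (d : ℕ) : IsFiniteMeasure (torusMeasure d) := by
  unfold torusMeasure
  exact ⟨by simpa using (isCompact_Icc (a := fun _ : Fin d => -Real.pi)).measure_lt_top⟩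

lemma torusMeasure_eq_pi (d : ℕ) : torusMeasure d =
    Measure.pi fun _ : Fin d => (volume : Measure ℝ).restrict (Set.Icc (-Real.pi) Real.pi) := by
  rw [torusMeasure, ← Set.pi_univ_Icc, volume_pi, Measure.restrict_pi_pi]

/-- The character `t ↦ e^{-i⟨t,m⟩}`. -/
def torusChar {d : ℕ} (m : Fin d → ℤ) (t : Fin d → ℝ) : ℂ :=
  Complex.exp (-Complex.I * ((∑ j, t j * (m j : ℝ) : ℝ) : ℂ))

lemma continuous_torusChar {d : ℕ} (m : Fin d → ℤ) : Continuous (torusChar m) := by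
  unfold torusChar; fun_prop

lemma norm_torusChar {d : ℕ} (m : Fin d → ℤ) (t : Fin d → ℝ) : ‖torusChar m t‖ = 1 := by
  rw [torusChar, show -Complex.I * ((∑ j, t j * (m j : ℝ) : ℝ) : ℂ) =
    ((-∑ j, t j * (m j : ℝ) : ℝ) : ℂ) * Complex.I by push_cast; ring]
  exact Complex.norm_exp_ofReal_mul_I _

lemma torusChar_mul_conj {d : ℕ} (m n : Fin d → ℤ) (t : Fin d → ℝ) :
    torusChar m t * starRingEnd ℂ (torusChar n t) = torusChar (m - n) t := by
  simp only [torusChar, ← Complex.exp_conj, ← Complex.exp_add]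
  congr 1
  simp only [map_mul, map_neg, Complex.conj_I, Complex.conj_ofReal, Pi.sub_apply]
  push_cast
  simp only [mul_sub, Finset.sum_sub_distrib]
  ring

lemma torusChar_zero {d : ℕ} (t : Fin d → ℝ) : torusChar 0 t = 1 := by
  simp [torusChar]

lemma integral_exp_int_mul {n : ℤ} (hn : n ≠ 0) :
    ∫ x in Set.Icc (-Real.pi) Real.pi, Complex.exp (-Complex.I * n * x) = 0 := by
  rw [integral_Icc_eq_integral_Ioc, ← intervalIntegral.integral_of_le (by linarith [Real.pi_pos]),
    integral_exp_mul_complex (by simp [hn])]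
  have : Complex.exp (-Complex.I * n * (Real.pi : ℝ)) =
      Complex.exp (-Complex.I * n * ((-Real.pi : ℝ) : ℂ)) := by
    rw [Complex.exp_eq_exp_iff_exists_int]
    exact ⟨-n, by push_cast; ring⟩
  rw [this, sub_self, zero_div]

lemma integral_torusChar {d : ℕ} {m : Fin d → ℤ} (hm : m ≠ 0) :
    ∫ t, torusChar m t ∂(torusMeasure d) = 0 := by
  have h : ∀ t : Fin d → ℝ, torusChar m t = ∏ j, Complex.exp (-Complex.I * m j * t j) := by
    intro t
    rw [torusChar, ← Complex.exp_sum, Complex.ofReal_sum, Finset.mul_sum]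
    congr 1
    refine Finset.sum_congr rfl fun j _ => ?_
    push_cast; ring
  obtain ⟨j, hj⟩ := Function.ne_iff.1 hm
  simp_rw [h, torusMeasure_eq_pi]
  rw [integral_fintype_prod_eq_prod (f := fun j (x : ℝ) => Complex.exp (-Complex.I * m j * x))]
  exact Finset.prod_eq_zero (Finset.mem_univ j) (integral_exp_int_mul hj)

lemma torusFourierCoeff_eq {d : ℕ} (f : (Fin d → ℝ) → ℂ) (m : Fin d → ℤ) :
    torusFourierCoeff f m = ∫ t, f t * torusChar m t ∂(torusMeasure d) := rfl

lemma enorm_torusFourierCoeff_le {d : ℕ} (f : (Fin d → ℝ) → ℂ) (m : Fin d → ℤ) :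
    ‖torusFourierCoeff f m‖ₑ ≤ ∫⁻ t, ‖f t‖ₑ ∂(torusMeasure d) := by
  rw [torusFourierCoeff_eq]
  refine (enorm_integral_le_lintegral_enorm _).trans (le_of_eq ?_)
  refine lintegral_congr fun t => ?_
  rw [enorm_mul, ← ofReal_norm (torusChar m t), norm_torusChar]
  simp

lemma integrable_mul_torusChar {d : ℕ} {f : (Fin d → ℝ) → ℂ}
    (hf : Integrable f (torusMeasure d)) (m : Fin d → ℤ) :
    Integrable (fun t => f t * torusChar m t) (torusMeasure d) :=
  hf.mul_bdd (c := 1) (continuous_torusChar m).aestronglyMeasurable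
    (Filter.Eventually.of_forall fun t => (norm_torusChar m t).le)

lemma torusFourierCoeff_add {d : ℕ} {f g : (Fin d → ℝ) → ℂ}
    (hf : Integrable f (torusMeasure d)) (hg : Integrable g (torusMeasure d)) (m : Fin d → ℤ) :
    torusFourierCoeff (f + g) m = torusFourierCoeff f m + torusFourierCoeff g m := by
  simp only [torusFourierCoeff_eq, Pi.add_apply, add_mul]
  exact integral_add (integrable_mul_torusChar hf m) (integrable_mul_torusChar hg m)

lemma torusFourierCoeff_smul {d : ℕ} (a : ℂ) (f : (Fin d → ℝ) → ℂ) (m : Fin d → ℤ) :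
    torusFourierCoeff (a • f) m = a * torusFourierCoeff f m := by
  simp only [torusFourierCoeff_eq, Pi.smul_apply, smul_eq_mul, mul_assoc]
  exact integral_const_mul _ _

lemma torusFourierCoeff_congr {d : ℕ} {f g : (Fin d → ℝ) → ℂ} (h : f =ᵐ[torusMeasure d] g)
    (m : Fin d → ℤ) : torusFourierCoeff f m = torusFourierCoeff g m :=
  integral_congr_ae (h.mono fun t ht => by simp only [ht])

/-- The total mass of the torus. -/
def torusMass (d : ℕ) : ℝ := (torusMeasure d).real Set.univ

lemma torusMass_pos (d : ℕ) : 0 < torusMass d := by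
  rw [torusMass, measureReal_def, torusMeasure_eq_pi, Measure.pi_univ]
  have : 0 < (ENNReal.ofReal (Real.pi + Real.pi)).toReal :=
    ENNReal.toReal_pos (by simp [Real.pi_pos]) ENNReal.ofReal_ne_top
  simp [this]

/-- The normalized conjugate characters as elements of `L²`. -/
def torusL2 {d : ℕ} (m : Fin d → ℤ) : Lp ℂ 2 (torusMeasure d) :=
  (((Real.sqrt (torusMass d))⁻¹ : ℝ) : ℂ) •
    MemLp.toLp (fun t => starRingEnd ℂ (torusChar m t))
      (MemLp.of_bound (Complex.continuous_conj.comp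
        (continuous_torusChar m)).aestronglyMeasurable 1
        (Filter.Eventually.of_forall fun t => by simp [norm_torusChar]))

/-- The inner product is conjugate-linear in its first slot; this is why `torusL2` is built from
conjugate characters. -/
lemma inner_torusL2 {d : ℕ} (m : Fin d → ℤ) (g : Lp ℂ 2 (torusMeasure d)) :
    inner ℂ (torusL2 m) g = (((Real.sqrt (torusMass d))⁻¹ : ℝ) : ℂ) * torusFourierCoeff g m := by
  rw [torusL2, inner_smul_left, Complex.conj_ofReal, L2.inner_def, torusFourierCoeff_eq]
  congr 1
  refine integral_congr_ae ?_
  filter_upwards [MemLp.coeFn_toLp (MemLp.of_bound (p := 2) (μ := torusMeasure d)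
    (Complex.continuous_conj.comp (continuous_torusChar m)).aestronglyMeasurable 1
        (Filter.Eventually.of_forall fun t => by simp [norm_torusChar]))] with t ht
  erw [ht]
  simp

lemma orthonormal_torusL2 (d : ℕ) : Orthonormal ℂ (torusL2 (d := d)) := by
  classical
  rw [orthonormal_iff_ite]
  intro m n
  have hpos := torusMass_pos d
  rw [inner_torusL2]
  have hco : torusFourierCoeff (torusL2 n : Lp ℂ 2 (torusMeasure d)) m =
      (((Real.sqrt (torusMass d))⁻¹ : ℝ) : ℂ) * ∫ t, torusChar (m - n) t ∂(torusMeasure d) := by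
    rw [torusL2, torusFourierCoeff_congr (Lp.coeFn_smul _ _), torusFourierCoeff_smul,
      torusFourierCoeff_congr (MemLp.coeFn_toLp _), torusFourierCoeff_eq]
    congr 1
    refine integral_congr_ae (Filter.Eventually.of_forall fun t => ?_)
    simp only [← torusChar_mul_conj]
    ring
  rw [hco]
  split_ifs with h
  · subst h
    simp only [sub_self, torusChar_zero, integral_const]
    rw [← mul_assoc, ← Complex.ofReal_mul, ← mul_inv, Real.mul_self_sqrt hpos.le,
      Complex.real_smul, mul_one, ← Complex.ofReal_mul]
    change (((torusMass d)⁻¹ * torusMass d : ℝ) : ℂ) = 1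
    rw [inv_mul_cancel₀ hpos.ne', Complex.ofReal_one]
  · rw [integral_torusChar (sub_ne_zero.2 h), mul_zero, mul_zero]

/-- Bessel's inequality for finitely many Fourier coefficients. -/
lemma sum_enorm_sq_torusFourierCoeff_le {d : ℕ} {g : (Fin d → ℝ) → ℂ}
    (hg : MemLp g 2 (torusMeasure d)) (A : Finset (Fin d → ℤ)) :
    ∑ m ∈ A, ‖torusFourierCoeff g m‖ₑ ^ (2 : ℝ) ≤
      ENNReal.ofReal (torusMass d) * ∫⁻ t, ‖g t‖ₑ ^ (2 : ℝ) ∂(torusMeasure d) := by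
  have hpos := torusMass_pos d
  have h := (orthonormal_torusL2 d).sum_inner_products_le (hg.toLp g) (s := A)
  have h1 : ∀ m, ‖inner ℂ (torusL2 m) (hg.toLp g)‖ ^ 2 =
      (torusMass d)⁻¹ * ‖torusFourierCoeff g m‖ ^ 2 := by
    intro m
    rw [inner_torusL2, torusFourierCoeff_congr hg.coeFn_toLp, norm_mul, mul_pow,
      Complex.norm_real, Real.norm_eq_abs, sq_abs, inv_pow, Real.sq_sqrt hpos.le]
  simp_rw [h1] at h
  -- The coefficients are taken without normalization, so the total mass appears as a factor in
  -- Bessel's inequality.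
  rw [← Finset.mul_sum, inv_mul_le_iff₀ hpos] at h
  have h2 : ENNReal.ofReal (‖hg.toLp g‖ ^ 2) = ∫⁻ t, ‖g t‖ₑ ^ (2 : ℝ) ∂(torusMeasure d) := by
    rw [Lp.norm_toLp, ENNReal.ofReal_pow ENNReal.toReal_nonneg,
      ENNReal.ofReal_toReal hg.eLpNorm_ne_top,
      eLpNorm_eq_lintegral_rpow_enorm_toReal (by simp) (by simp), ← ENNReal.rpow_natCast,
      ← ENNReal.rpow_mul]
    simp
  rw [← h2, ← ENNReal.ofReal_mul hpos.le]
  refine le_trans (le_of_eq ?_) (ENNReal.ofReal_le_ofReal h)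
  rw [ENNReal.ofReal_sum_of_nonneg fun _ _ => by positivity]
  refine Finset.sum_congr rfl fun m _ => ?_
  rw [ENNReal.ofReal_pow (norm_nonneg _), ofReal_norm, ← ENNReal.rpow_natCast]
  simp

/-! ### Paley's inequality -/

lemma sum_inv_sq_filter_le (K : Finset ℕ) {s : ℝ} (hs : 0 < s) :
    ∑ k ∈ K with s < ((k : ℕ) : ℝ) + 1, (((k : ℝ) + 1) ^ 2)⁻¹ ≤ 2 / s := by
  classical
  set A := K.filter fun k : ℕ => s < (k : ℝ) + 1
  have h1 : ∑ k ∈ A, (((k : ℝ) + 1) ^ 2)⁻¹ =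
      ∑ i ∈ A.image (fun k : ℕ => k + 1), ((i : ℝ) ^ 2)⁻¹ := by
    rw [Finset.sum_image (fun a _ b _ h => Nat.succ_injective h)]
    exact Finset.sum_congr rfl fun k _ => by push_cast; rfl
  have hsub : A.image (fun k : ℕ => k + 1) ⊆ Finset.Ioo ⌊s⌋₊ (K.sup id + 2) := by
    intro i hi
    obtain ⟨k, hk, rfl⟩ := Finset.mem_image.1 hi
    obtain ⟨hkK, hks⟩ := Finset.mem_filter.1 hk
    have hle : k ≤ K.sup id := Finset.le_sup (f := id) hkK
    refine Finset.mem_Ioo.2 ⟨(Nat.floor_lt hs.le).2 (by push_cast; exact hks), by omega⟩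
  rw [h1]
  calc _ ≤ ∑ i ∈ Finset.Ioo ⌊s⌋₊ (K.sup id + 2), ((i : ℝ) ^ 2)⁻¹ :=
        Finset.sum_le_sum_of_subset_of_nonneg hsub fun _ _ _ => by positivity
    _ ≤ 2 / (⌊s⌋₊ + 1) := sum_Ioo_inv_sq_le _ _
    _ ≤ 2 / s := by
        gcongr
        exact (Nat.lt_floor_add_one s).le

/-- Weak type `(1, 1)` bound with respect to the weights `(k + 1)⁻²`. -/
lemma sum_inv_sq_level_le_of_bound (K : Finset ℕ) {b : ℕ → ℝ} {H τ : ℝ} (hb : ∀ k, b k ≤ H)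
    (hτ : 0 < τ) (hH : 0 ≤ H) :
    ∑ k ∈ K with τ < ((k : ℕ) + 1 : ℝ) * b k, (((k : ℝ) + 1) ^ 2)⁻¹ ≤ 2 * H / τ := by
  rcases hH.eq_or_lt with rfl | hH
  · rw [Finset.filter_eq_empty_iff.2]
    · simp
    · intro k _
      have : ((k : ℕ) + 1 : ℝ) * b k ≤ 0 := mul_nonpos_of_nonneg_of_nonpos (by positivity) (hb k)
      linarith
  · refine le_trans (Finset.sum_le_sum_of_subset_of_nonneg ?_ fun _ _ _ => by positivity)
      ((sum_inv_sq_filter_le K (div_pos hτ hH)).trans_eq (by field_simp))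
    -- On the level set `τ < (k + 1) H`, so only the tail `k + 1 > τ / H` of the series contributes.
    intro k hk
    obtain ⟨hkK, hk⟩ := Finset.mem_filter.1 hk
    refine Finset.mem_filter.2 ⟨hkK, ?_⟩
    rw [div_lt_iff₀ hH]
    exact hk.trans_le (by gcongr; exact hb k)

/-- Weak type `(2, 2)` bound with respect to the weights `(k + 1)⁻²`. -/
lemma sum_inv_sq_level_le_sum_sq (K : Finset ℕ) {b : ℕ → ℝ} {τ : ℝ} (hτ : 0 < τ) :
    ∑ k ∈ K with τ < ((k : ℕ) + 1 : ℝ) * b k, (((k : ℝ) + 1) ^ 2)⁻¹ ≤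
      (∑ k ∈ K, b k ^ 2) / τ ^ 2 := by
  rw [Finset.sum_div]
  refine le_trans (Finset.sum_le_sum fun k hk => ?_)
    (Finset.sum_le_sum_of_subset_of_nonneg (Finset.filter_subset _ _) fun _ _ _ => by positivity)
  have hk := (Finset.mem_filter.1 hk).2
  -- Chebyshev: on the level set `(k + 1)⁻² ≤ b k ^ 2 / τ ^ 2`.
  rw [le_div_iff₀ (by positivity), inv_mul_le_iff₀ (by positivity), ← mul_pow]
  gcongr

/-- The layer cake formula for a finite weighted sum. -/
lemma sum_mul_rpow_eq_lintegral_level (K : Finset ℕ) (W : ℕ → ℝ≥0∞) {g : ℕ → ℝ}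
    (hg : ∀ k, 0 ≤ g k) {p : ℝ} (hp : 0 < p) :
    ∑ k ∈ K, W k * ENNReal.ofReal (g k ^ p) = ENNReal.ofReal p *
      ∫⁻ τ in Set.Ioi (0 : ℝ), (∑ k ∈ K with τ < g k, W k) * ENNReal.ofReal (τ ^ (p - 1)) := by
  classical
  set ν : Measure ℕ := ∑ k ∈ K, W k • Measure.dirac k with hν
  have h := lintegral_rpow_eq_lintegral_meas_lt_mul ν (f := g) (Filter.Eventually.of_forall hg)
    (by fun_prop) hp
  have h1 : ∫⁻ k, ENNReal.ofReal (g k ^ p) ∂ν = ∑ k ∈ K, W k * ENNReal.ofReal (g k ^ p) := by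
    rw [hν, lintegral_finsetSum_measure]
    simp [lintegral_smul_measure]
  have h2 : ∀ τ : ℝ, ν {k | τ < g k} = ∑ k ∈ K with τ < g k, W k := by
    intro τ
    rw [hν, Measure.finsetSum_apply, Finset.sum_filter]
    refine Finset.sum_congr rfl fun k _ => ?_
    simp [Set.indicator_apply]
  rw [← h1, h]
  simp_rw [h2]

/-- The kernel obtained from the weak type bounds at level `τ` for a value of size `y`. -/
def paleyKernel (p M τ y : ℝ) : ℝ :=
  if τ ≤ y then 4 * y * τ ^ (p - 2) else 4 * M * y ^ 2 * τ ^ (p - 3)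

lemma measurable_paleyKernel (p M : ℝ) : Measurable fun z : ℝ × ℝ => paleyKernel p M z.1 z.2 := by
  unfold paleyKernel
  exact Measurable.ite (measurableSet_le measurable_fst measurable_snd) (by fun_prop) (by fun_prop)

/-- The piece `τ ≤ y` is integrable at `0` because `p > 1`, the piece `τ > y` is integrable at
infinity because `p < 2`; both scale like `y ^ p`. The constant blows up at either endpoint. -/
lemma lintegral_paleyKernel_le {p M y : ℝ} (h1 : 1 < p) (h2 : p < 2) (hM : 0 ≤ M) (hy : 0 ≤ y) :
    ∫⁻ τ in Set.Ioi (0 : ℝ), ENNReal.ofReal (paleyKernel p M τ y) ≤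
      ENNReal.ofReal ((4 / (p - 1) + 4 * M / (2 - p)) * y ^ p) := by
  rcases hy.eq_or_lt with rfl | hy
  · rw [setLIntegral_congr_fun measurableSet_Ioi (g := fun _ => 0)]
    · simp
    · intro τ hτ
      have : ¬ τ ≤ 0 := not_le.2 (Set.mem_Ioi.1 hτ)
      simp [paleyKernel, this]
  rw [← Set.Ioc_union_Ioi_eq_Ioi hy.le,
    lintegral_union measurableSet_Ioi (Set.Ioc_disjoint_Ioi le_rfl)]
  have hA : ∫⁻ τ in Set.Ioc 0 y, ENNReal.ofReal (paleyKernel p M τ y) =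
      ENNReal.ofReal (4 / (p - 1) * y ^ p) := by
    have hint : IntegrableOn (fun τ : ℝ => 4 * y * τ ^ (p - 2)) (Set.Ioc 0 y) := by
      rw [← intervalIntegrable_iff_integrableOn_Ioc_of_le hy.le]
      exact (intervalIntegral.intervalIntegrable_rpow' (by linarith)).const_mul _
    calc _ = ∫⁻ τ in Set.Ioc 0 y, ENNReal.ofReal (4 * y * τ ^ (p - 2)) := by
          refine setLIntegral_congr_fun measurableSet_Ioc fun τ hτ => ?_
          simp only [paleyKernel, if_pos hτ.2]
      _ = ENNReal.ofReal (∫ τ in Set.Ioc 0 y, 4 * y * τ ^ (p - 2)) := by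
          rw [ofReal_integral_eq_lintegral_ofReal hint]
          filter_upwards [ae_restrict_mem measurableSet_Ioc] with τ hτ
          have := hτ.1
          positivity
      _ = _ := by
          rw [← intervalIntegral.integral_of_le hy.le, intervalIntegral.integral_const_mul,
            integral_rpow (Or.inl (by linarith)), Real.zero_rpow (by linarith)]
          congr 1
          have e : y ^ p = y ^ (p - 1) * y := by
            rw [← Real.rpow_add_one hy.ne', sub_add_cancel]
          rw [e, show p - 2 + 1 = p - 1 by ring]
          ring
  have hB : ∫⁻ τ in Set.Ioi y, ENNReal.ofReal (paleyKernel p M τ y) =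
      ENNReal.ofReal (4 * M / (2 - p) * y ^ p) := by
    have hint : IntegrableOn (fun τ : ℝ => 4 * M * y ^ 2 * τ ^ (p - 3)) (Set.Ioi y) :=
      (integrableOn_Ioi_rpow_of_lt (by linarith) hy).const_mul _
    calc _ = ∫⁻ τ in Set.Ioi y, ENNReal.ofReal (4 * M * y ^ 2 * τ ^ (p - 3)) := by
          refine setLIntegral_congr_fun measurableSet_Ioi fun τ hτ => ?_
          simp only [paleyKernel, if_neg (not_le.2 (Set.mem_Ioi.1 hτ))]
      _ = ENNReal.ofReal (∫ τ in Set.Ioi y, 4 * M * y ^ 2 * τ ^ (p - 3)) := by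
          rw [ofReal_integral_eq_lintegral_ofReal hint]
          filter_upwards [ae_restrict_mem measurableSet_Ioi] with τ hτ
          have : 0 < τ := hy.trans hτ
          positivity
      _ = _ := by
          rw [integral_const_mul, integral_Ioi_rpow_of_lt (by linarith) hy]
          congr 1
          have e : y ^ p = y ^ (p - 3 + 1) * y ^ 2 := by
            rw [← Real.rpow_natCast, ← Real.rpow_add hy]; congr 1; push_cast; ring
          rw [e]
          have h3 : p - 3 + 1 ≠ 0 := by linarith
          have h4 : 2 - p ≠ 0 := by linarith
          have h5 : p - 2 ≠ 0 := by linarith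
          rw [show p - 3 + 1 = -(2 - p) by ring]
          field_simp
  rw [hA, hB, ← ENNReal.ofReal_add (by have : 0 < p - 1 := by linarith
                                       positivity) (by have : 0 < 2 - p := by linarith
                                                       positivity)]
  exact ENNReal.ofReal_le_ofReal (by rw [add_mul])

/-- The Marcinkiewicz splitting at height `τ`: the large part `h` of `f` is treated by the weak
(1,1) bound, the bounded part `g`, which lies in `L²`, by the weak (2,2) bound. -/
lemma sum_inv_sq_level_torusFourierCoeff_le {d : ℕ} {f : (Fin d → ℝ) → ℂ} (hfm : Measurable f)
    (hf : Integrable f (torusMeasure d)) (p : ℝ) (K : Finset ℕ) (e : ℕ → Fin d → ℤ)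
    (he : Set.InjOn e K) {τ : ℝ} (hτ : 0 < τ) :
    (∑ k ∈ K with τ < ((k : ℕ) + 1 : ℝ) * ‖torusFourierCoeff f (e k)‖,
      ENNReal.ofReal (((k : ℝ) + 1) ^ 2)⁻¹) * ENNReal.ofReal (τ ^ (p - 1)) ≤
    ∫⁻ t, ENNReal.ofReal (paleyKernel p (torusMass d) τ ‖f t‖) ∂(torusMeasure d) := by
  classical
  set μ := torusMeasure d with hμ
  set S : Set (Fin d → ℝ) := {t | τ ≤ ‖f t‖} with hS
  have hSm : MeasurableSet S := measurableSet_le measurable_const hfm.norm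
  set h := S.indicator f with hh
  set g := Sᶜ.indicator f with hg
  have hM := torusMass_pos d
  have hhi : Integrable h μ := hf.indicator hSm
  have hgi : Integrable g μ := hf.indicator hSm.compl
  have hg2 : MemLp g 2 μ := by
    refine MemLp.of_bound hgi.aestronglyMeasurable τ (Filter.Eventually.of_forall fun t => ?_)
    by_cases ht : t ∈ S
    · simp [hg, ht, hτ.le]
    · rw [hg, Set.indicator_of_mem (Set.mem_compl ht)]
      exact le_of_lt (not_le.1 ht)
  have hfg : f = h + g := (Set.indicator_self_add_compl S f).symm
  set H := ∫ t, ‖h t‖ ∂μ with hHdef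
  set G := ∫ t, ‖g t‖ ^ 2 ∂μ with hGdef
  have hH0 : 0 ≤ H := integral_nonneg fun _ => norm_nonneg _
  have hG0 : 0 ≤ G := integral_nonneg fun _ => by positivity
  have hHe : ENNReal.ofReal H = ∫⁻ t, ‖h t‖ₑ ∂μ := ofReal_integral_norm_eq_lintegral_enorm hhi
  have hG2 : Integrable (fun t => ‖g t‖ ^ 2) μ := hg2.integrable_norm_pow (by norm_num)
  have hhb : ∀ k, ‖torusFourierCoeff h (e k)‖ ≤ H := by
    intro k
    rw [← ENNReal.ofReal_le_ofReal_iff hH0, ofReal_norm, hHe]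
    exact enorm_torusFourierCoeff_le h (e k)
  have hgb : ∑ k ∈ K, ‖torusFourierCoeff g (e k)‖ ^ 2 ≤ torusMass d * G := by
    have hb := sum_enorm_sq_torusFourierCoeff_le hg2 (K.image e)
    rw [Finset.sum_image he] at hb
    have e1 : ∀ z : ℂ, ‖z‖ₑ ^ (2 : ℝ) = ENNReal.ofReal (‖z‖ ^ 2) := by
      intro z
      rw [ENNReal.ofReal_pow (norm_nonneg _), ofReal_norm, ← ENNReal.rpow_natCast]; simp
    simp_rw [e1] at hb
    rw [← ofReal_integral_eq_lintegral_ofReal hG2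
      (Filter.Eventually.of_forall fun _ => by positivity),
      ← ENNReal.ofReal_sum_of_nonneg fun _ _ => by positivity, ← ENNReal.ofReal_mul hM.le] at hb
    exact (ENNReal.ofReal_le_ofReal_iff (by positivity)).1 hb
  have hlevel : ∑ k ∈ K with τ < ((k : ℕ) + 1 : ℝ) * ‖torusFourierCoeff f (e k)‖,
      (((k : ℝ) + 1) ^ 2)⁻¹ ≤ 4 * H / τ + 4 * torusMass d * G / τ ^ 2 := by
    -- If the sum of the two contributions exceeds `τ`, one of them exceeds `τ / 2`; the halving
    -- produces the factors 4 in `paleyKernel`.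
    have hsub : (K.filter fun k : ℕ => τ < ((k : ℕ) + 1 : ℝ) * ‖torusFourierCoeff f (e k)‖) ⊆
        (K.filter fun k : ℕ => τ / 2 < ((k : ℕ) + 1 : ℝ) * ‖torusFourierCoeff h (e k)‖) ∪
        (K.filter fun k : ℕ => τ / 2 < ((k : ℕ) + 1 : ℝ) * ‖torusFourierCoeff g (e k)‖) := by
      intro k hk
      obtain ⟨hkK, hk⟩ := Finset.mem_filter.1 hk
      rw [Finset.mem_union, Finset.mem_filter, Finset.mem_filter]
      by_contra hcon
      push Not at hcon
      have a1 := hcon.1 hkK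
      have a2 := hcon.2 hkK
      have a3 : ‖torusFourierCoeff f (e k)‖ ≤
          ‖torusFourierCoeff h (e k)‖ + ‖torusFourierCoeff g (e k)‖ := by
        rw [hfg, torusFourierCoeff_add hhi hgi]
        exact norm_add_le _ _
      have a4 := mul_le_mul_of_nonneg_left a3 (by positivity : (0 : ℝ) ≤ (k : ℝ) + 1)
      rw [mul_add] at a4
      linarith
    refine (Finset.sum_le_sum_of_subset_of_nonneg hsub fun _ _ _ => by positivity).trans ?_
    refine (le_add_of_nonneg_right (Finset.sum_nonneg fun _ _ => by positivity)).trans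
      (Finset.sum_union_inter (f := fun k : ℕ => (((k : ℝ) + 1) ^ 2)⁻¹)).le |>.trans ?_
    calc _ ≤ 2 * H / (τ / 2) + torusMass d * G / (τ / 2) ^ 2 :=
        add_le_add (sum_inv_sq_level_le_of_bound K hhb (by positivity) hH0)
          ((sum_inv_sq_level_le_sum_sq K (by positivity)).trans (by gcongr))
      _ = _ := by field_simp; ring
  have hker : ∀ t, paleyKernel p (torusMass d) τ ‖f t‖ =
      4 * τ ^ (p - 2) * ‖h t‖ + 4 * torusMass d * τ ^ (p - 3) * ‖g t‖ ^ 2 := by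
    intro t
    by_cases ht : t ∈ S
    · have ht' : τ ≤ ‖f t‖ := ht
      rw [paleyKernel, if_pos ht', hh, hg, Set.indicator_of_mem ht,
        Set.indicator_of_notMem (by simpa using ht)]
      simp; ring
    · have ht' : ¬ τ ≤ ‖f t‖ := ht
      rw [paleyKernel, if_neg ht', hh, hg, Set.indicator_of_notMem ht,
        Set.indicator_of_mem (Set.mem_compl ht)]
      simp; ring
  simp_rw [hker]
  have hI : Integrable (fun t => 4 * τ ^ (p - 2) * ‖h t‖ +
      4 * torusMass d * τ ^ (p - 3) * ‖g t‖ ^ 2) μ :=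
    (hhi.norm.const_mul _).add (hG2.const_mul _)
  rw [← ofReal_integral_eq_lintegral_ofReal hI
      (Filter.Eventually.of_forall fun _ => by simp only [Pi.zero_apply]; positivity),
    integral_add (hhi.norm.const_mul _) (hG2.const_mul _), integral_const_mul, integral_const_mul,
    ← ENNReal.ofReal_sum_of_nonneg (fun _ _ => by positivity), ← ENNReal.ofReal_mul
      (Finset.sum_nonneg fun _ _ => by positivity)]
  refine ENNReal.ofReal_le_ofReal ((mul_le_mul_of_nonneg_right hlevel (by positivity)).trans_eq ?_)
  have e2 : τ ^ (p - 2) = τ ^ (p - 1) / τ := by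
    rw [← Real.rpow_sub_one hτ.ne']; congr 1; ring
  have e3 : τ ^ (p - 3) = τ ^ (p - 1) / τ ^ 2 := by
    rw [← Real.rpow_sub_natCast hτ.ne']; congr 1; push_cast; ring
  rw [e2, e3, ← hHdef, ← hGdef]
  ring

/-- The constant in Paley's inequality. -/
def paleyConst (d : ℕ) (p : ℝ) : ℝ := p * (4 / (p - 1) + 4 * torusMass d / (2 - p))

lemma paleyConst_pos (d : ℕ) {p : ℝ} (h1 : 1 < p) (h2 : p < 2) : 0 < paleyConst d p := by
  have := torusMass_pos d
  have : 0 < p - 1 := by linarith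
  have : 0 < 2 - p := by linarith
  unfold paleyConst
  positivity

/-- Since `(1/p' - 1/p) p = p - 2`, the left side is the `p`-th moment of `(k + 1) |f̂(e k)|` for
the masses `(k + 1)⁻²`. The layer cake formula, the level estimate and Tonelli reduce it to the
integral of `paleyKernel` in `τ`. The constant does not depend on `K` or `e`, which permits the
passage to the rearrangement. -/
lemma sum_weight_torusFourierCoeff_le {d : ℕ} {f : (Fin d → ℝ) → ℂ} (hfm : Measurable f)
    (hf : Integrable f (torusMeasure d)) {p : ℝ} (h1 : 1 < p) (h2 : p < 2) (K : Finset ℕ)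
    (e : ℕ → Fin d → ℤ) (he : Set.InjOn e K) :
    ∑ k ∈ K, (Lorentz.weight p.conjExponent p k * ‖torusFourierCoeff f (e k)‖ₑ) ^ p ≤
      ENNReal.ofReal (paleyConst d p) * ∫⁻ t, ‖f t‖ₑ ^ p ∂(torusMeasure d) := by
  have hp0 : 0 < p := by linarith
  have hM := torusMass_pos d
  have hexp : (1 / p.conjExponent - 1 / p) * p = p - 2 := by
    rw [Real.conjExponent]
    have : p - 1 ≠ 0 := by linarith
    field_simp
    ring
  have hterm : ∀ k : ℕ, (Lorentz.weight p.conjExponent p k * ‖torusFourierCoeff f (e k)‖ₑ) ^ p =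
      ENNReal.ofReal (((k : ℝ) + 1) ^ 2)⁻¹ *
        ENNReal.ofReal ((((k : ℕ) + 1 : ℝ) * ‖torusFourierCoeff f (e k)‖) ^ p) := by
    intro k
    have hk : (0 : ℝ) < (k : ℝ) + 1 := by positivity
    rw [ENNReal.mul_rpow_of_nonneg _ _ hp0.le, Lorentz.weight, ← ENNReal.rpow_mul, hexp,
      Real.mul_rpow hk.le (norm_nonneg _), ← ENNReal.ofReal_mul (by positivity), ← mul_assoc,
      ENNReal.ofReal_mul (by positivity), ← ENNReal.ofReal_rpow_of_nonneg (norm_nonneg _) hp0.le,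
      ofReal_norm]
    congr 1
    rw [show ((k : ℝ≥0∞) + 1) = ENNReal.ofReal ((k : ℝ) + 1) by
        rw [ENNReal.ofReal_add (by positivity) zero_le_one]; simp,
      ENNReal.ofReal_rpow_of_pos hk]
    congr 1
    rw [show p - 2 = p - (2 : ℕ) by push_cast; ring, Real.rpow_sub_natCast hk.ne']
    ring
  simp_rw [hterm]
  rw [sum_mul_rpow_eq_lintegral_level K _ (fun k => by positivity) hp0]
  have hswap : ∫⁻ τ in Set.Ioi (0 : ℝ), (∫⁻ t, ENNReal.ofReal (paleyKernel p (torusMass d) τ ‖f t‖)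
      ∂(torusMeasure d)) = ∫⁻ t, (∫⁻ τ in Set.Ioi (0 : ℝ),
        ENNReal.ofReal (paleyKernel p (torusMass d) τ ‖f t‖)) ∂(torusMeasure d) := by
    refine lintegral_lintegral_swap (Measurable.aemeasurable ?_)
    exact ENNReal.measurable_ofReal.comp ((measurable_paleyKernel p _).comp
      (measurable_fst.prodMk (hfm.norm.comp measurable_snd)))
  calc _ ≤ ENNReal.ofReal p * ∫⁻ τ in Set.Ioi (0 : ℝ), (∫⁻ t,
        ENNReal.ofReal (paleyKernel p (torusMass d) τ ‖f t‖) ∂(torusMeasure d)) := by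
        refine mul_le_mul' le_rfl ?_
        exact setLIntegral_mono' measurableSet_Ioi fun τ hτ =>
          sum_inv_sq_level_torusFourierCoeff_le hfm hf p K e he (Set.mem_Ioi.1 hτ)
    _ ≤ ENNReal.ofReal p * ∫⁻ t, ENNReal.ofReal
        ((4 / (p - 1) + 4 * torusMass d / (2 - p)) * ‖f t‖ ^ p) ∂(torusMeasure d) := by
        rw [hswap]
        gcongr with t
        exact lintegral_paleyKernel_le h1 h2 hM.le (norm_nonneg _)
    _ = _ := by
        have hc : 0 ≤ 4 / (p - 1) + 4 * torusMass d / (2 - p) := by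
          have : 0 < p - 1 := by linarith
          have : 0 < 2 - p := by linarith
          positivity
        simp_rw [ENNReal.ofReal_mul hc, ← ENNReal.ofReal_rpow_of_nonneg (norm_nonneg _) hp0.le,
          ofReal_norm]
        rw [lintegral_const_mul' _ _ ENNReal.ofReal_ne_top, ← mul_assoc,
          ← ENNReal.ofReal_mul hp0.le, paleyConst]

/-- **Paley's inequality** on the torus. -/
lemma eNorm_torusFourierCoeff_le {d : ℕ} {f : (Fin d → ℝ) → ℂ} (hfm : Measurable f)
    (hf : Integrable f (torusMeasure d)) {p : ℝ} (h1 : 1 < p) (h2 : p < 2) :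
    Lorentz.eNorm p.conjExponent p (torusFourierCoeff f) ≤
      ENNReal.ofReal (paleyConst d p) ^ (1 / p) *
        eLpNorm f (ENNReal.ofReal p) (torusMeasure d) := by
  classical
  have hp0 : 0 < p := by linarith
  set c := torusFourierCoeff f
  have hfin : ∀ k, Lorentz.rearr c k ≠ ∞ := fun k =>
    ne_top_of_le_ne_top hf.2.ne ((Lorentz.rearr_antitone c (Nat.zero_le k)).trans
      (Lorentz.rearr_zero_le (enorm_torusFourierCoeff_le f)))
  -- The factor `θ < 1` leaves room below each nonzero `rearr c k`, so distinct frequencies with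
  -- coefficients above `θ * rearr c k` exist without asking whether the infimum is attained.
  -- Indices outside `K` have zero rearrangement.
  refine ENNReal.le_of_forall_lt_one_mul_le fun θ hθ => ?_
  have hpart : ∀ n : ℕ, ∑ k ∈ Finset.range n,
      (Lorentz.weight p.conjExponent p k * (θ * Lorentz.rearr c k)) ^ p ≤
        ENNReal.ofReal (paleyConst d p) * ∫⁻ t, ‖f t‖ₑ ^ p ∂(torusMeasure d) := by
    intro n
    obtain ⟨e, he, hτ⟩ := Lorentz.exists_inj c (fun k => θ * Lorentz.rearr c k) n
    set K := (Finset.range n).filter fun k => θ * Lorentz.rearr c k < Lorentz.rearr c k with hK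
    have heK : Set.InjOn e K := he.mono fun k hk => by simpa [hK] using hk
    refine le_trans ?_ (sum_weight_torusFourierCoeff_le hfm hf h1 h2 K e heK)
    rw [← Finset.sum_subset (Finset.filter_subset _ _ : K ⊆ Finset.range n)]
    · refine Finset.sum_le_sum fun k hk => ENNReal.rpow_le_rpow ?_ hp0.le
      have hk' := Finset.mem_filter.1 hk
      gcongr
      exact (hτ k (Finset.mem_range.1 hk'.1) hk'.2).le
    · intro k hk hkK
      have h0 : Lorentz.rearr c k = 0 := by
        by_contra hne
        refine hkK (Finset.mem_filter.2 ⟨hk, ?_⟩)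
        calc θ * Lorentz.rearr c k < 1 * Lorentz.rearr c k :=
              ENNReal.mul_lt_mul_left hne (hfin k) hθ
          _ = _ := one_mul _
      simp [h0, hp0]
  have hsum : θ ^ p * ∑' k : ℕ, (Lorentz.weight p.conjExponent p k * Lorentz.rearr c k) ^ p ≤
      ENNReal.ofReal (paleyConst d p) * ∫⁻ t, ‖f t‖ₑ ^ p ∂(torusMeasure d) := by
    rw [← ENNReal.tsum_mul_left, ENNReal.tsum_eq_iSup_nat]
    refine iSup_le fun n => le_trans (le_of_eq ?_) (hpart n)
    refine Finset.sum_congr rfl fun k _ => ?_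
    rw [← ENNReal.mul_rpow_of_nonneg _ _ hp0.le, mul_left_comm]
  have h := ENNReal.rpow_le_rpow hsum (by positivity : 0 ≤ 1 / p)
  rw [ENNReal.mul_rpow_of_nonneg _ _ (by positivity), ← ENNReal.rpow_mul,
    mul_one_div_cancel hp0.ne', ENNReal.rpow_one,
    ENNReal.mul_rpow_of_nonneg _ _ (by positivity)] at h
  rw [eLpNorm_eq_lintegral_rpow_enorm_toReal (by simpa using hp0) (by simp),
    ENNReal.toReal_ofReal hp0.le]
  exact h

/-! ### The Fourier transform as an operator into the Lorentz space -/

lemma Lp_integrable_torus {d : ℕ} {p : ℝ} [h1 : Fact (1 < p)]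
    (f : Lp ℂ (ENNReal.ofReal p) (torusMeasure d)) : Integrable f (torusMeasure d) :=
  (Lp.memLp f).integrable factOneLeOfReal.out

lemma eNorm_torusFourierCoeff_Lp_le {d : ℕ} {p : ℝ} [h1 : Fact (1 < p)] [h2 : Fact (p < 2)]
    (f : Lp ℂ (ENNReal.ofReal p) (torusMeasure d)) :
    Lorentz.eNorm p.conjExponent p (torusFourierCoeff f) ≤
      ENNReal.ofReal (paleyConst d p ^ (1 / p) * ‖f‖) := by
  have hC := paleyConst_pos d h1.out h2.out
  rw [ENNReal.ofReal_mul (by positivity), ← ENNReal.ofReal_rpow_of_pos hC, Lp.norm_def,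
    ENNReal.ofReal_toReal (Lp.eLpNorm_ne_top f)]
  exact eNorm_torusFourierCoeff_le (Lp.stronglyMeasurable f).measurable (Lp_integrable_torus f)
    h1.out h2.out

/-- The discrete Fourier transform `L^p(𝕋^d) → l^{p',p}(ℤ^d)`. -/
def torusFourier (d : ℕ) (p : ℝ) [Fact (1 < p)] [Fact (p < 2)] :
    Lp ℂ (ENNReal.ofReal p) (torusMeasure d) →L[ℂ] LorentzSeq (Fin d → ℤ) p.conjExponent p :=
  LinearMap.mkContinuous
    { toFun := fun f => ⟨torusFourierCoeff f,
        (eNorm_torusFourierCoeff_Lp_le f).trans_lt ENNReal.ofReal_lt_top⟩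
      map_add' := fun f g => Subtype.ext (funext fun m =>
        (torusFourierCoeff_congr (Lp.coeFn_add f g) m).trans
          (torusFourierCoeff_add (Lp_integrable_torus f) (Lp_integrable_torus g) m))
      map_smul' := fun a f => Subtype.ext (funext fun m =>
        (torusFourierCoeff_congr (Lp.coeFn_smul a f) m).trans (torusFourierCoeff_smul a f m)) }
    (paleyConst d p ^ (1 / p)) fun f => by
      have hC := paleyConst_pos d (p := p) Fact.out Fact.out
      exact ENNReal.toReal_le_of_le_ofReal (by positivity) (eNorm_torusFourierCoeff_Lp_le f)

lemma torusFourier_apply {d : ℕ} {p : ℝ} [Fact (1 < p)] [Fact (p < 2)]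
    (f : Lp ℂ (ENNReal.ofReal p) (torusMeasure d)) (m : Fin d → ℤ) :
    torusFourier d p f m = torusFourierCoeff f m := rfl

lemma LorentzSeq.ofReal_norm_eq {ι : Type*} {r s : ℝ} [Fact (1 ≤ s)] [Fact (s ≤ r)]
    (c : LorentzSeq ι r s) : ENNReal.ofReal ‖c‖ = Lorentz.eNorm r s c.1 :=
  ENNReal.ofReal_toReal (ne_of_lt c.2)

/-! ### A gliding hump argument -/

open Filter Topology in
/-- A sequence of summable rows which tends to zero in every column has a subsequence whose rows
are concentrated on successive intervals. -/
lemma exists_gliding_hump (U : ℕ → ℕ → ℝ≥0∞) (hfin : ∀ j, ∑' k, U j k ≠ ∞)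
    (h0 : ∀ k, Tendsto (fun j => U j k) atTop (𝓝 0)) (ε : ℕ → ℝ≥0∞) (hε : ∀ n, 0 < ε n) :
    ∃ φ M : ℕ → ℕ, StrictMono φ ∧ Monotone M ∧
      (∀ n, ∑ k ∈ Finset.range (M n), U (φ n) k ≤ ε n) ∧
      (∀ n j, j ≤ n → ∑' k, U (φ j) (k + M (n + 1)) ≤ ε (n + 1)) := by
  have hhead : ∀ N M n, ∃ j, N < j ∧ ∑ k ∈ Finset.range M, U j k ≤ ε n := by
    intro N M n
    have ht : Tendsto (fun j => ∑ k ∈ Finset.range M, U j k) atTop (𝓝 0) := by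
      simpa using tendsto_finsetSum (Finset.range M) fun k _ => h0 k
    obtain ⟨j, hj, hj'⟩ := ((eventually_gt_atTop N).and (ht.eventually_le_const (hε n))).exists
    exact ⟨j, hj, hj'⟩
  have htail : ∀ N M n, ∃ M', M ≤ M' ∧ ∀ j ≤ N, ∑' k, U j (k + M') ≤ ε n := by
    intro N M n
    have ht : ∀ j ∈ Set.Iic N, ∀ᶠ M' in atTop, ∑' k, U j (k + M') ≤ ε n := fun j _ =>
      (ENNReal.tendsto_sum_nat_add (U j) (hfin j)).eventually_le_const (hε n)
    obtain ⟨M', h1, h2⟩ := ((eventually_ge_atTop M).and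
      ((eventually_all_finite (Set.finite_Iic N)).2 ht)).exists
    exact ⟨M', h1, fun j hj => h2 j hj⟩
  choose α hα hα' using hhead
  choose β hβ hβ' using htail
  -- The state is `(φ n, M n)`. The cut `M (n + 1)` is chosen first, making the tails of all rows up
  -- to `φ n` small; then `φ (n + 1)` is chosen so late that its head before that cut is small.
  -- Starting with `M 0 = 0` makes the first head empty.
  let s : ℕ → ℕ × ℕ := fun n => Nat.rec (α 0 0 0, 0)
    (fun n x => (α x.1 (β x.1 x.2 (n + 1)) (n + 1), β x.1 x.2 (n + 1))) n
  have hs1 : ∀ n, (s (n + 1)).1 = α (s n).1 (s (n + 1)).2 (n + 1) := fun n => rfl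
  have hs2 : ∀ n, (s (n + 1)).2 = β (s n).1 (s n).2 (n + 1) := fun n => rfl
  have hφ : StrictMono fun n => (s n).1 := strictMono_nat_of_lt_succ fun n => by
    rw [hs1]; exact hα _ _ _
  refine ⟨fun n => (s n).1, fun n => (s n).2, hφ, monotone_nat_of_le_succ fun n => ?_, ?_, ?_⟩
  · rw [hs2]; exact hβ _ _ _
  · rintro (_ | n)
    · simp [s]
    · simp only [hs1]; exact hα' _ _ _
  · intro n j hj
    simp only [hs2]
    exact hβ' _ _ _ _ (hφ.monotone hj)

/-- The off-diagonal and diagonal estimates over the blocks of a gliding hump. -/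
lemma gliding_hump_blocks {U : ℕ → ℕ → ℝ≥0∞} {ε : ℕ → ℝ≥0∞} {φ M : ℕ → ℕ} (hεa : Antitone ε)
    (hM : Monotone M) (h1 : ∀ n, ∑ k ∈ Finset.range (M n), U (φ n) k ≤ ε n)
    (h2 : ∀ n j, j ≤ n → ∑' k, U (φ j) (k + M (n + 1)) ≤ ε (n + 1)) :
    (∀ n j, j ≠ n → ∑ k ∈ Finset.Ico (M n) (M (n + 1)), U (φ j) k ≤ ε (max n j)) ∧
    (∀ n, ∑' k, U (φ n) k ≤ ∑ k ∈ Finset.Ico (M n) (M (n + 1)), U (φ n) k + 2 * ε n) := by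
  constructor
  · intro n j hjn
    -- For `j < n` the block lies in the controlled tail of row `φ j`; for `j > n` it lies in the
    -- small head of that row.
    rcases lt_or_gt_of_ne hjn with h | h
    · rw [max_eq_left h.le]
      obtain ⟨n, rfl⟩ : ∃ i, n = i + 1 := ⟨n - 1, by omega⟩
      refine le_trans ?_ (h2 n j (by omega))
      rw [Finset.sum_Ico_eq_sum_range]
      simp_rw [add_comm (M (n + 1)) _]
      exact ENNReal.sum_le_tsum _
    · rw [max_eq_right h.le]
      refine le_trans (Finset.sum_le_sum_of_subset fun k hk => ?_) (h1 j)
      have : M (n + 1) ≤ M j := hM h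
      exact Finset.mem_range.2 ((Finset.mem_Ico.1 hk).2.trans_le this)
  · intro n
    rw [← Summable.sum_add_tsum_nat_add' (f := U (φ n)) (k := M (n + 1)) ENNReal.summable,
      ← Finset.sum_range_add_sum_Ico _ (hM n.le_succ), two_mul]
    calc _ ≤ (ε n + ∑ k ∈ Finset.Ico (M n) (M (n + 1)), U (φ n) k) + ε n :=
          add_le_add (add_le_add (h1 n) le_rfl) ((h2 n n le_rfl).trans (hεa n.le_succ))
      _ = _ := by ring

/-- Peeling off the first term repeatedly with `(x + y)^p ≤ 2 (x^p + y^p)` gives coefficients that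
do not depend on `N`. Their growth is harmless against the decay `4^{-max(n, j)}` of the
off-diagonal blocks. -/
lemma sum_rpow_le_sum_two_pow_mul (N : ℕ) {p : ℝ} (h1 : 1 ≤ p) (h2 : p ≤ 2) :
    ∀ x : ℕ → ℝ≥0∞, (∑ j ∈ Finset.range N, x j) ^ p ≤
      ∑ j ∈ Finset.range N, 2 ^ (j + 1) * x j ^ p := by
  induction N with
  | zero => intro x; simp [show 0 < p by linarith]
  | succ N ih =>
    intro x
    rw [Finset.sum_range_succ', Finset.sum_range_succ']
    calc _ ≤ (2 : ℝ≥0∞) ^ (p - 1) * ((∑ j ∈ Finset.range N, x (j + 1)) ^ p + x 0 ^ p) :=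
          ENNReal.rpow_add_le_mul_rpow_add_rpow _ _ h1
      _ ≤ (2 : ℝ≥0∞) ^ (1 : ℝ) * (∑ j ∈ Finset.range N, 2 ^ (j + 1) * x (j + 1) ^ p + x 0 ^ p) := by
          gcongr
          · norm_num
          · linarith
          · exact ih _
      _ = _ := by
          rw [ENNReal.rpow_one, mul_add, Finset.mul_sum]
          congr 1
          · refine Finset.sum_congr rfl fun j _ => ?_
            ring
          · ring

lemma sum_sum_Ico_le {M : ℕ → ℕ} (hM : Monotone M) (f : ℕ → ℝ≥0∞) (N : ℕ) :
    ∑ n ∈ Finset.range N, ∑ k ∈ Finset.Ico (M n) (M (n + 1)), f k ≤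
      ∑ k ∈ Finset.range (M N), f k := by
  induction N with
  | zero => simp
  | succ N ih =>
    rw [Finset.sum_range_succ, ← Finset.sum_range_add_sum_Ico _ (hM N.le_succ)]
    gcongr

/-- A superposition of rows that are nearly supported on disjoint blocks is bounded below in
`ℓ^p`. -/
lemma le_sum_of_blocks {p : ℝ} (hp1 : 1 ≤ p) (hp2 : p ≤ 2) {u : ℕ → ℕ → ℝ≥0∞} {M : ℕ → ℕ}
    (hM : Monotone M) {ε : ℝ≥0∞} (hεt : ε ≠ ∞)
    (hoff : ∀ n j, j ≠ n →
      ∑ k ∈ Finset.Ico (M n) (M (n + 1)), u j k ^ p ≤ ε * (4⁻¹) ^ (max n j))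
    (hdiag : ∀ n, 20 * ε ≤ ∑ k ∈ Finset.Ico (M n) (M (n + 1)), u n k ^ p + 2 * ε)
    {N : ℕ} {a v : ℕ → ℝ≥0∞} (ha : ∀ n, a n ≠ ∞)
    (hv : ∀ n ∈ Finset.range N, ∀ k, a n * u n k ≤
      v k + ∑ j ∈ Finset.range N, if j = n then 0 else a j * u j k) :
    5 * ε * ∑ n ∈ Finset.range N, a n ^ p ≤ ∑ k ∈ Finset.range (M N), v k ^ p := by
  have hp0 : 0 < p := by linarith
  set A := ∑ n ∈ Finset.range N, a n ^ p with hA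
  have hAt : A ≠ ∞ := ENNReal.sum_ne_top.2 fun n _ => ENNReal.rpow_ne_top_of_nonneg hp0.le (ha n)
  set B : ℕ → Finset ℕ := fun n => Finset.Ico (M n) (M (n + 1)) with hB
  have hrow : ∀ n ∈ Finset.range N, a n ^ p * ∑ k ∈ B n, u n k ^ p ≤
      2 * ∑ k ∈ B n, v k ^ p + 4 * ε * (2⁻¹) ^ n * A := by
    intro n hn
    calc a n ^ p * ∑ k ∈ B n, u n k ^ p = ∑ k ∈ B n, (a n * u n k) ^ p := by
          rw [Finset.mul_sum]
          exact Finset.sum_congr rfl fun k _ => (ENNReal.mul_rpow_of_nonneg _ _ hp0.le).symm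
      _ ≤ ∑ k ∈ B n, (2 * v k ^ p + 2 * ∑ j ∈ Finset.range N,
            if j = n then 0 else 2 ^ (j + 1) * (a j ^ p * u j k ^ p)) := by
          refine Finset.sum_le_sum fun k _ => ?_
          refine (ENNReal.rpow_le_rpow (hv n hn k) hp0.le).trans ?_
          refine (ENNReal.rpow_add_le_mul_rpow_add_rpow _ _ hp1).trans ?_
          rw [← mul_add]
          have h2 : (2 : ℝ≥0∞) ^ (p - 1) ≤ 2 := by
            calc (2 : ℝ≥0∞) ^ (p - 1) ≤ 2 ^ (1 : ℝ) :=
                  ENNReal.rpow_le_rpow_of_exponent_le (by norm_num) (by linarith)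
              _ = 2 := ENNReal.rpow_one _
          refine mul_le_mul' h2 (add_le_add le_rfl ?_)
          refine (sum_rpow_le_sum_two_pow_mul N hp1 hp2 _).trans (Finset.sum_le_sum fun j _ => ?_)
          split_ifs
          · simp [hp0]
          · rw [ENNReal.mul_rpow_of_nonneg _ _ hp0.le]
      _ = 2 * ∑ k ∈ B n, v k ^ p + 2 * ∑ j ∈ Finset.range N,
            if j = n then 0 else 2 ^ (j + 1) * a j ^ p * ∑ k ∈ B n, u j k ^ p := by
          rw [Finset.sum_add_distrib, ← Finset.mul_sum, ← Finset.mul_sum, Finset.sum_comm]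
          congr 2
          refine Finset.sum_congr rfl fun j _ => ?_
          split_ifs
          · simp
          · rw [Finset.mul_sum]
            exact Finset.sum_congr rfl fun k _ => by ring
      _ ≤ 2 * ∑ k ∈ B n, v k ^ p + 2 * ∑ j ∈ Finset.range N, 2 * ε * (2⁻¹) ^ n * a j ^ p := by
          gcongr with j _
          split_ifs with hj
          · exact bot_le
          · have h4 : (4⁻¹ : ℝ≥0∞) = 2⁻¹ * 2⁻¹ := by
              rw [← ENNReal.mul_inv (by simp) (by simp)]; norm_num
            -- One factor `2^{-max(n, j)}` absorbs `2 ^ j`; the other leaves `2^{-n}`, summable over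
            -- the blocks.
            have h5 : (2 : ℝ≥0∞) ^ j * (4⁻¹) ^ (max n j) ≤ (2⁻¹) ^ n := by
              rw [h4, mul_pow]
              calc (2 : ℝ≥0∞) ^ j * ((2⁻¹) ^ (max n j) * (2⁻¹) ^ (max n j))
                  ≤ 2 ^ j * ((2⁻¹) ^ j * (2⁻¹) ^ n) := by
                    refine mul_le_mul' le_rfl (mul_le_mul' ?_ ?_)
                    · exact pow_le_pow_right_of_le_one' (by simp) (le_max_right _ _)
                    · exact pow_le_pow_right_of_le_one' (by simp) (le_max_left _ _)
                _ = (2⁻¹) ^ n := by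
                    rw [← mul_assoc, ← mul_pow, ENNReal.mul_inv_cancel (by simp) (by simp),
                      one_pow, one_mul]
            calc 2 ^ (j + 1) * a j ^ p * ∑ k ∈ B n, u j k ^ p
                ≤ 2 ^ (j + 1) * a j ^ p * (ε * (4⁻¹) ^ (max n j)) := by
                  gcongr; exact hoff n j hj
              _ = 2 * ε * (2 ^ j * (4⁻¹) ^ (max n j)) * a j ^ p := by ring
              _ ≤ _ := by gcongr
      _ = _ := by
          rw [← Finset.mul_sum]; ring
  have hgeom : ∑ n ∈ Finset.range N, (2⁻¹ : ℝ≥0∞) ^ n ≤ 2 := by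
    refine (ENNReal.sum_le_tsum _).trans ?_
    rw [ENNReal.tsum_geometric, ENNReal.one_sub_inv_two, inv_inv]
  -- The loss is `4 ε A` times a geometric sum at most 2, plus `2 ε A` from the diagonal defect. Of
  -- the 20 in `hdiag`, 10 remain, and halving gives the 5 of the conclusion.
  have hmain : 20 * ε * A ≤ 2 * ∑ k ∈ Finset.range (M N), v k ^ p + 10 * ε * A := by
    calc 20 * ε * A = ∑ n ∈ Finset.range N, a n ^ p * (20 * ε) := by
          rw [← Finset.sum_mul, mul_comm]
      _ ≤ ∑ n ∈ Finset.range N, a n ^ p * (∑ k ∈ B n, u n k ^ p + 2 * ε) := by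
          gcongr with n _
          exact hdiag n
      _ = ∑ n ∈ Finset.range N, a n ^ p * ∑ k ∈ B n, u n k ^ p + 2 * ε * A := by
          simp_rw [mul_add]
          rw [Finset.sum_add_distrib, ← Finset.sum_mul, mul_comm A]
      _ ≤ ∑ n ∈ Finset.range N, (2 * ∑ k ∈ B n, v k ^ p + 4 * ε * (2⁻¹) ^ n * A) + 2 * ε * A := by
          gcongr with n hn
          exact hrow n hn
      _ = 2 * ∑ n ∈ Finset.range N, ∑ k ∈ B n, v k ^ p +
            4 * ε * (∑ n ∈ Finset.range N, (2⁻¹) ^ n) * A + 2 * ε * A := by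
          rw [Finset.sum_add_distrib, ← Finset.mul_sum, ← Finset.sum_mul, ← Finset.mul_sum]
      _ ≤ 2 * ∑ k ∈ Finset.range (M N), v k ^ p + 4 * ε * 2 * A + 2 * ε * A := by
          gcongr
          exact sum_sum_Ico_le hM _ N
      _ = _ := by ring
  have hfin : 10 * ε * A ≠ ∞ := ENNReal.mul_ne_top (ENNReal.mul_ne_top (by simp) hεt) hAt
  have h10 : 2 * (5 * ε * A) ≤ 2 * ∑ k ∈ Finset.range (M N), v k ^ p := by
    rw [show 20 * ε * A = 2 * (5 * ε * A) + 10 * ε * A by ring] at hmain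
    exact ENNReal.le_of_add_le_add_right hfin hmain
  exact (ENNReal.mul_le_mul_iff_right (by simp) (by simp)).1 h10

/-! ### Disjointly supported test functions -/

/-- The slab of points whose `i`-th coordinate lies in `(2^{-(j+1)}, 2^{-j}]`. -/
def torusSlab {d : ℕ} (i : Fin d) (j : ℕ) : Set (Fin d → ℝ) :=
  {t | t i ∈ Set.Ioc ((1 / 2 : ℝ) ^ (j + 1)) ((1 / 2 : ℝ) ^ j)}

lemma measurableSet_torusSlab {d : ℕ} (i : Fin d) (j : ℕ) : MeasurableSet (torusSlab i j) :=
  measurable_pi_apply i measurableSet_Ioc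

lemma disjoint_torusSlab {d : ℕ} (i : Fin d) {j l : ℕ} (h : j ≠ l) {t : Fin d → ℝ}
    (hj : t ∈ torusSlab i j) : t ∉ torusSlab i l := by
  intro hl
  have key : ∀ {j l : ℕ}, j < l → t ∈ torusSlab i j → t ∈ torusSlab i l → False := by
    intro j l hlt hj hl
    have h1 : (1 / 2 : ℝ) ^ l ≤ (1 / 2 : ℝ) ^ (j + 1) :=
      pow_le_pow_of_le_one (by norm_num) (by norm_num) hlt
    exact absurd (hj.1.trans_le (hl.2.trans h1)) (lt_irrefl _)
  rcases lt_or_gt_of_ne h with h | h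
  · exact key h hj hl
  · exact key h hl hj

lemma exists_torusMeasure_torusSlab {d : ℕ} (i : Fin d) : ∃ κ : ℝ, 0 < κ ∧
    ∀ j, torusMeasure d (torusSlab i j) = ENNReal.ofReal (κ * (1 / 2) ^ j) := by
  classical
  set ν : Measure ℝ := (volume : Measure ℝ).restrict (Set.Icc (-Real.pi) Real.pi) with hν
  have hν0 : ν Set.univ ≠ 0 := by simp [hν, Real.pi_pos]
  have hνt : ν Set.univ ≠ ∞ := measure_ne_top _ _
  set P : ℝ≥0∞ := ∏ j ∈ Finset.univ.erase i, ν Set.univ with hP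
  have hP0 : P ≠ 0 := Finset.prod_ne_zero_iff.2 fun _ _ => hν0
  have hPt : P ≠ ∞ := ENNReal.prod_ne_top fun _ _ => hνt
  -- `P` is the volume of the other coordinates; the half comes from the interval length `2^{-j} -
  -- 2^{-(j+1)} = 2^{-j} / 2`.
  refine ⟨P.toReal / 2, by have := ENNReal.toReal_pos hP0 hPt; positivity, fun j => ?_⟩
  have h1 : torusMeasure d (torusSlab i j) =
      P * ν (Set.Ioc ((1 / 2 : ℝ) ^ (j + 1)) ((1 / 2 : ℝ) ^ j)) := by
    have h := Measure.pi_map_eval (fun _ : Fin d => ν) i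
    rw [torusMeasure_eq_pi]
    change Measure.pi (fun _ : Fin d => ν) (Function.eval i ⁻¹' _) = _
    rw [← Measure.map_apply (measurable_pi_apply i) measurableSet_Ioc, h]
    rfl
  have hsub : Set.Ioc ((1 / 2 : ℝ) ^ (j + 1)) ((1 / 2 : ℝ) ^ j) ⊆
      Set.Icc (-Real.pi) Real.pi := by
    intro x hx
    have hx0 : 0 < x := lt_trans (by positivity) hx.1
    have hx1 : x ≤ 1 := hx.2.trans (pow_le_one₀ (by norm_num) (by norm_num))
    have := Real.pi_gt_three
    exact ⟨by linarith, by linarith⟩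
  rw [h1, hν, Measure.restrict_apply measurableSet_Ioc, Set.inter_eq_left.2 hsub, Real.volume_Ioc]
  conv_lhs => rw [← ENNReal.ofReal_toReal hPt]
  rw [← ENNReal.ofReal_mul ENNReal.toReal_nonneg]
  congr 1
  rw [pow_succ]
  ring

/-- The height making the `L^p` norms of the indicators of the slabs independent of `j`. -/
def bumpHeight (p : ℝ) (j : ℕ) : ℝ := ((2 : ℝ) ^ j) ^ (1 / p)

lemma bumpHeight_pos (p : ℝ) (j : ℕ) : 0 < bumpHeight p j := by unfold bumpHeight; positivity

/-- The normalized indicator function of a slab. -/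
def bumpFun {d : ℕ} (i : Fin d) (p : ℝ) (j : ℕ) : (Fin d → ℝ) → ℂ :=
  (torusSlab i j).indicator fun _ => (bumpHeight p j : ℂ)

lemma memLp_bumpFun {d : ℕ} (i : Fin d) (p : ℝ) (j : ℕ) (q : ℝ≥0∞) :
    MemLp (bumpFun i p j) q (torusMeasure d) :=
  (memLp_const _).indicator (measurableSet_torusSlab i j)

lemma lintegral_enorm_rpow_bumpFun {d : ℕ} (i : Fin d) (p : ℝ) (j : ℕ) {q : ℝ} (hq : 0 < q) :
    ∫⁻ t, ‖bumpFun i p j t‖ₑ ^ q ∂(torusMeasure d) =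
      ENNReal.ofReal (bumpHeight p j ^ q) * torusMeasure d (torusSlab i j) := by
  have h : ∀ t, ‖bumpFun i p j t‖ₑ ^ q =
      (torusSlab i j).indicator (fun _ => ENNReal.ofReal (bumpHeight p j ^ q)) t := by
    intro t
    by_cases ht : t ∈ torusSlab i j
    · rw [bumpFun, Set.indicator_of_mem ht, Set.indicator_of_mem ht, ← ofReal_norm,
        Complex.norm_real, Real.norm_of_nonneg (bumpHeight_pos p j).le,
        ENNReal.ofReal_rpow_of_pos (bumpHeight_pos p j)]
    · rw [bumpFun, Set.indicator_of_notMem ht, Set.indicator_of_notMem ht]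
      simp [hq]
  simp_rw [h]
  rw [lintegral_indicator_const (measurableSet_torusSlab i j)]

lemma enorm_torusFourierCoeff_bumpFun_le {d : ℕ} (i : Fin d) (p : ℝ) (j : ℕ) (m : Fin d → ℤ) :
    ‖torusFourierCoeff (bumpFun i p j) m‖ₑ ≤
      ENNReal.ofReal (bumpHeight p j) * torusMeasure d (torusSlab i j) := by
  refine (enorm_torusFourierCoeff_le _ m).trans (le_of_eq ?_)
  simpa using lintegral_enorm_rpow_bumpFun i p j zero_lt_one

lemma re_torusChar_single {d : ℕ} (i : Fin d) (k : ℤ) (t : Fin d → ℝ) :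
    (torusChar (Pi.single i k) t).re = Real.cos (t i * k) := by
  classical
  have h : ∑ j, t j * (((Pi.single i k : Fin d → ℤ) j : ℤ) : ℝ) = t i * k := by
    rw [Finset.sum_eq_single i]
    · simp
    · intro j _ hj; simp [hj]
    · simp
  rw [torusChar, h, show -Complex.I * ((t i * k : ℝ) : ℂ) = ((-(t i * k) : ℝ) : ℂ) * Complex.I by
    push_cast; ring, Complex.exp_ofReal_mul_I_re, Real.cos_neg]

/-- No cancellation: on the slab `0 ≤ t i * k ≤ 1`, so the real part of the character is `cos (t i *
k) ≥ 1 - 1/2`. -/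
lemma le_enorm_torusFourierCoeff_bumpFun {d : ℕ} (i : Fin d) (p : ℝ) {j k : ℕ} (hk : k < 2 ^ j) :
    ENNReal.ofReal (bumpHeight p j / 2) * torusMeasure d (torusSlab i j) ≤
      ‖torusFourierCoeff (bumpFun i p j) (Pi.single i (k : ℤ))‖ₑ := by
  set μ := torusMeasure d
  set S := torusSlab i j
  have hS : MeasurableSet S := measurableSet_torusSlab i j
  have hh := bumpHeight_pos p j
  have hc : torusFourierCoeff (bumpFun i p j) (Pi.single i (k : ℤ)) =
      (bumpHeight p j : ℂ) * ∫ t in S, torusChar (Pi.single i (k : ℤ)) t ∂μ := by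
    rw [torusFourierCoeff_eq, ← integral_const_mul, ← integral_indicator hS]
    refine integral_congr_ae (Filter.Eventually.of_forall fun t => ?_)
    by_cases ht : t ∈ S
    · simp only [bumpFun, Set.indicator_of_mem ht, S]
    · simp only [bumpFun, Set.indicator_of_notMem ht, zero_mul, S]
  have hint : Integrable (torusChar (Pi.single i (k : ℤ))) (μ.restrict S) :=
    Integrable.of_bound (continuous_torusChar _).aestronglyMeasurable 1
      (Filter.Eventually.of_forall fun t => (norm_torusChar _ t).le)
  have hre : μ.real S / 2 ≤ (∫ t in S, torusChar (Pi.single i (k : ℤ)) t ∂μ).re := by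
    have h1 : (∫ t in S, torusChar (Pi.single i (k : ℤ)) t ∂μ).re =
        ∫ t in S, (torusChar (Pi.single i (k : ℤ)) t).re ∂μ :=
      (Complex.reCLM.integral_comp_comm hint).symm
    rw [h1]
    have h2 : ∫ t in S, (1 / 2 : ℝ) ∂μ ≤ ∫ t in S, (torusChar (Pi.single i (k : ℤ)) t).re ∂μ := by
      refine setIntegral_mono_on (integrable_const _) hint.re hS fun t ht => ?_
      rw [re_torusChar_single]
      have ht0 : 0 < t i := lt_trans (by positivity) ht.1
      have hk' : (k : ℝ) ≤ 2 ^ j := by exact_mod_cast hk.le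
      have h3 : t i * k ≤ 1 := by
        calc t i * k ≤ (1 / 2) ^ j * 2 ^ j := by
              gcongr
              exact ht.2
          _ = 1 := by rw [← mul_pow]; norm_num
      have h4 : 0 ≤ t i * k := by positivity
      have h5 := Real.one_sub_sq_div_two_le_cos (x := t i * k)
      push_cast
      nlinarith
    refine le_trans (le_of_eq ?_) h2
    rw [setIntegral_const, smul_eq_mul]
    ring
  rw [hc, enorm_mul, ← ofReal_norm, Complex.norm_real, Real.norm_of_nonneg hh.le,
    ← ofReal_norm, ← ENNReal.ofReal_toReal (measure_ne_top μ S),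
    ← ENNReal.ofReal_mul (by positivity), ← ENNReal.ofReal_mul hh.le]
  refine ENNReal.ofReal_le_ofReal ?_
  have h6 : μ.real S / 2 ≤ ‖∫ t in S, torusChar (Pi.single i (k : ℤ)) t ∂μ‖ :=
    hre.trans (Complex.re_le_norm _)
  calc bumpHeight p j / 2 * (μ S).toReal = bumpHeight p j * (μ.real S / 2) := by
        rw [measureReal_def]; ring
    _ ≤ _ := by gcongr

/-- The weighted Fourier coefficients of the test functions along a coordinate axis. -/
def bumpRow {d : ℕ} (i : Fin d) (p : ℝ) (j k : ℕ) : ℝ≥0∞ :=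
  Lorentz.weight p.conjExponent p k * ‖torusFourierCoeff (bumpFun i p j) (Pi.single i (k : ℤ))‖ₑ

/-- Because the weights decrease, any injective listing of frequencies bounds the Lorentz norm from
below. Fixing the axis listing replaces the nonlinear rearrangement by weighted coordinates that
depend linearly on `c`, as the block argument requires. -/
lemma sum_weight_rpow_le_eNorm {d : ℕ} (i : Fin d) {p : ℝ} [h1 : Fact (1 < p)] [h2 : Fact (p < 2)]
    (c : (Fin d → ℤ) → ℂ) (n : ℕ) :
    ∑ k ∈ Finset.range n, (Lorentz.weight p.conjExponent p k * ‖c (Pi.single i (k : ℤ))‖ₑ) ^ p ≤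
      Lorentz.eNorm p.conjExponent p c ^ p := by
  have hp0 : 0 < p := by linarith [h1.out]
  have h := Lorentz.sum_inj_le (r := p.conjExponent) (s := p) h1.out.le factLeConjExponent.out c n
    (Finset.range n) le_rfl (fun k => Pi.single i (k : ℤ))
    (fun a _ b _ hab => by simpa using Pi.single_injective i hab)
  have h' := ENNReal.rpow_le_rpow h hp0.le
  rwa [← ENNReal.rpow_mul, one_div_mul_cancel hp0.ne', ENNReal.rpow_one] at h'

lemma tsum_bumpRow_ne_top {d : ℕ} (i : Fin d) {p : ℝ} [h1 : Fact (1 < p)] [h2 : Fact (p < 2)]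
    (j : ℕ) : ∑' k, bumpRow i p j k ^ p ≠ ∞ := by
  have hp0 : 0 < p := by linarith [h1.out]
  have hle := eNorm_torusFourierCoeff_Lp_le
    ((memLp_bumpFun i p j (ENNReal.ofReal p)).toLp (bumpFun i p j))
  have hfin := ENNReal.rpow_lt_top_of_nonneg hp0.le (hle.trans_lt ENNReal.ofReal_lt_top).ne
  refine ne_top_of_le_ne_top hfin.ne ?_
  rw [ENNReal.tsum_eq_iSup_nat]
  refine iSup_le fun n => le_trans (le_of_eq ?_) (sum_weight_rpow_le_eNorm i _ n)
  refine Finset.sum_congr rfl fun k _ => ?_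
  rw [bumpRow, torusFourierCoeff_congr (MemLp.coeFn_toLp _)]

lemma one_div_conjExponent {p : ℝ} (h1 : 1 < p) : 1 / p.conjExponent = 1 - 1 / p := by
  rw [Real.conjExponent]
  have : p - 1 ≠ 0 := by linarith
  field_simp

open Filter Topology in
-- Every coefficient is at most the `L¹` norm of the bump, which is `κ 2^{j(1/p - 1)}` and decays
-- since `p > 1`.
lemma tendsto_bumpRow {d : ℕ} (i : Fin d) {p : ℝ} [h1 : Fact (1 < p)] [h2 : Fact (p < 2)]
    (k : ℕ) : Tendsto (fun j => bumpRow i p j k ^ p) atTop (𝓝 0) := by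
  have hp1 := h1.out
  have hp0 : 0 < p := by linarith
  obtain ⟨κ, hκ, hκm⟩ := exists_torusMeasure_torusSlab i
  have hlim : Tendsto (fun j : ℕ => ENNReal.ofReal (κ * ((2 : ℝ) ^ (1 / p - 1)) ^ j)) atTop
      (𝓝 0) := by
    have hr : (2 : ℝ) ^ (1 / p - 1) < 1 := by
      refine Real.rpow_lt_one_of_one_lt_of_neg (by norm_num) ?_
      rw [sub_neg, div_lt_one hp0]; exact hp1
    have := (tendsto_pow_atTop_nhds_zero_of_lt_one (by positivity) hr).const_mul κ
    simpa using ENNReal.tendsto_ofReal this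
  have hrow : Tendsto (fun j => bumpRow i p j k) atTop (𝓝 0) := by
    refine tendsto_of_tendsto_of_tendsto_of_le_of_le tendsto_const_nhds hlim
      (fun _ => bot_le) fun j => ?_
    have hw : Lorentz.weight p.conjExponent p k ≤ 1 := by
      rw [← Lorentz.weight_zero p.conjExponent p]
      exact Lorentz.weight_antitone hp1.le factLeConjExponent.out (Nat.zero_le k)
    calc bumpRow i p j k ≤ 1 * (ENNReal.ofReal (bumpHeight p j) *
          torusMeasure d (torusSlab i j)) :=
          mul_le_mul' hw (enorm_torusFourierCoeff_bumpFun_le i p j _)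
      _ = _ := by
          rw [one_mul, hκm, ← ENNReal.ofReal_mul (bumpHeight_pos p j).le, bumpHeight]
          congr 1
          rw [← Real.rpow_pow_comm (by norm_num), Real.rpow_sub_one (by norm_num), div_pow,
            div_pow, one_pow]
          ring
  have := hrow.ennrpow_const p
  rwa [ENNReal.zero_rpow_of_pos hp0] at this

/-- With `X = 2^j`, each of the first `X` weights is at least `X^(1 - 2/p)` and each coefficient at
least `X^(1/p - 1) κ / 2`. The `p`-th power of the product is `X⁻¹ (κ/2)^p`, and there are `X` such
terms. -/
lemma le_tsum_bumpRow {d : ℕ} (i : Fin d) {p : ℝ} [h1 : Fact (1 < p)] [h2 : Fact (p < 2)]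
    {κ : ℝ} (hκ : 0 < κ)
    (hκm : ∀ j, torusMeasure d (torusSlab i j) = ENNReal.ofReal (κ * (1 / 2) ^ j)) (j : ℕ) :
    ENNReal.ofReal ((κ / 2) ^ p) ≤ ∑' k, bumpRow i p j k ^ p := by
  have hp1 := h1.out
  have hp0 : 0 < p := by linarith
  set X : ℝ := (2 : ℝ) ^ j with hX
  have hX0 : 0 < X := by positivity
  have hterm : ∀ k ∈ Finset.range (2 ^ j),
      ENNReal.ofReal (X⁻¹ * (κ / 2) ^ p) ≤ bumpRow i p j k ^ p := by
    intro k hk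
    have hk := Finset.mem_range.1 hk
    have hw : ENNReal.ofReal (X ^ (1 / p.conjExponent - 1 / p)) ≤
        Lorentz.weight p.conjExponent p k := by
      -- The weight is indexed from zero, so its value at `2 ^ j - 1` is exactly a power of `2 ^ j`.
      refine le_trans (le_of_eq ?_) (Lorentz.weight_antitone hp1.le factLeConjExponent.out
        (Nat.le_sub_one_of_lt hk))
      rw [Lorentz.weight, ← ENNReal.ofReal_rpow_of_pos hX0]
      congr 1
      have : ((2 ^ j - 1 : ℕ) : ℝ≥0∞) + 1 = ((2 ^ j : ℕ) : ℝ≥0∞) := by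
        exact_mod_cast Nat.sub_add_cancel (Nat.one_le_two_pow)
      rw [this, hX]
      simp [ENNReal.ofReal_pow]
    have hb := mul_le_mul' hw (le_enorm_torusFourierCoeff_bumpFun i p hk)
    rw [hκm, ← ENNReal.ofReal_mul (by have := bumpHeight_pos p j; positivity),
      ← ENNReal.ofReal_mul (by positivity)] at hb
    refine le_trans (le_of_eq ?_) (ENNReal.rpow_le_rpow hb hp0.le)
    rw [ENNReal.ofReal_rpow_of_pos (by have := bumpHeight_pos p j; positivity)]
    congr 1
    have e1 : X ^ (1 / p.conjExponent - 1 / p) * (bumpHeight p j / 2 * (κ * (1 / 2) ^ j)) =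
        X ^ (-(1 / p)) * (κ / 2) := by
      rw [bumpHeight, ← hX, one_div_pow, ← hX, one_div_conjExponent hp1,
        show 1 - 1 / p - 1 / p = -(1 / p) + 1 - 1 / p by ring, Real.rpow_sub hX0,
        Real.rpow_add_one hX0.ne']
      have : X ^ (1 / p) ≠ 0 := by positivity
      field_simp
    rw [e1, Real.mul_rpow (by positivity) (by positivity), ← Real.rpow_mul hX0.le,
      neg_mul, one_div_mul_cancel hp0.ne', Real.rpow_neg_one]
  refine le_trans ?_ (ENNReal.sum_le_tsum (Finset.range (2 ^ j)))
  refine le_trans (le_of_eq ?_) (Finset.sum_le_sum hterm)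
  rw [Finset.sum_const, Finset.card_range, nsmul_eq_mul,
    show (((2 ^ j : ℕ) : ℝ≥0∞)) = ENNReal.ofReal X by simp [hX, ENNReal.ofReal_pow],
    ← ENNReal.ofReal_mul hX0.le, mul_inv_cancel_left₀ (ne_of_gt hX0)]

/-! ### Failure of strict singularity -/

/-- The test functions as elements of `L^p`. -/
def bumpLp {d : ℕ} (i : Fin d) (p : ℝ) (j : ℕ) : Lp ℂ (ENNReal.ofReal p) (torusMeasure d) :=
  (memLp_bumpFun i p j (ENNReal.ofReal p)).toLp (bumpFun i p j)

lemma enorm_sum_rpow_le_of_disjoint {N : ℕ} {p : ℝ} (hp : 0 < p) {z : ℕ → ℂ}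
    (hz : ∀ n l, n ≠ l → z n ≠ 0 → z l = 0) :
    ‖∑ n ∈ Finset.range N, z n‖ₑ ^ p ≤ ∑ n ∈ Finset.range N, ‖z n‖ₑ ^ p := by
  by_cases h : ∃ n ∈ Finset.range N, z n ≠ 0
  · obtain ⟨n, hn, hzn⟩ := h
    rw [Finset.sum_eq_single_of_mem n hn fun l _ hl => hz n l hl.symm hzn]
    exact Finset.single_le_sum (f := fun n => ‖z n‖ₑ ^ p) (fun _ _ => bot_le) hn
  · push Not at h
    rw [Finset.sum_eq_zero h]
    simp [hp]

/-- The upper `p`-estimate for the disjointly supported test functions. -/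
lemma enorm_sum_bumpLp_rpow_le {d : ℕ} (i : Fin d) {p : ℝ} [h1 : Fact (1 < p)]
    {κ : ℝ} (hκ : 0 < κ)
    (hκm : ∀ j, torusMeasure d (torusSlab i j) = ENNReal.ofReal (κ * (1 / 2) ^ j))
    {φ : ℕ → ℕ} (hφ : Function.Injective φ) (N : ℕ) (a : ℕ → ℂ) :
    ‖∑ n ∈ Finset.range N, a n • bumpLp i p (φ n)‖ₑ ^ p ≤
      ENNReal.ofReal κ * ∑ n ∈ Finset.range N, ‖a n‖ₑ ^ p := by
  have hp0 : 0 < p := by linarith [h1.out]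
  have hpt : (ENNReal.ofReal p) ≠ 0 := by simpa using hp0
  rw [Lp.enorm_def, eLpNorm_eq_lintegral_rpow_enorm_toReal hpt (by simp),
    ENNReal.toReal_ofReal hp0.le, ← ENNReal.rpow_mul, one_div_mul_cancel hp0.ne', ENNReal.rpow_one]
  have hae : ∀ᵐ t ∂(torusMeasure d), (∑ n ∈ Finset.range N, a n • bumpLp i p (φ n) :
      Lp ℂ (ENNReal.ofReal p) (torusMeasure d)) t =
        ∑ n ∈ Finset.range N, a n * bumpFun i p (φ n) t := by
    have h2 : ∀ n ∈ (Finset.range N : Set ℕ), ∀ᵐ t ∂(torusMeasure d),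
        (a n • bumpLp i p (φ n) : Lp ℂ (ENNReal.ofReal p) (torusMeasure d)) t =
          a n * bumpFun i p (φ n) t := by
      intro n _
      filter_upwards [Lp.coeFn_smul (a n) (bumpLp i p (φ n)),
        (memLp_bumpFun i p (φ n) (ENNReal.ofReal p)).coeFn_toLp] with t ht ht'
      rw [ht, Pi.smul_apply, smul_eq_mul, bumpLp, ht']
    filter_upwards [Lp.coeFn_finsetSum (Finset.range N) fun n => a n • bumpLp i p (φ n),
      (ae_ball_iff (Finset.range N).countable_toSet).2 h2] with t ht ht'
    rw [ht, Finset.sum_apply]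
    exact Finset.sum_congr rfl fun n hn => ht' n hn
  calc _ = ∫⁻ t, ‖∑ n ∈ Finset.range N, a n * bumpFun i p (φ n) t‖ₑ ^ p ∂(torusMeasure d) :=
        lintegral_congr_ae (hae.mono fun t ht => by simp only [ht])
    _ ≤ ∫⁻ t, ∑ n ∈ Finset.range N, ‖a n‖ₑ ^ p * ‖bumpFun i p (φ n) t‖ₑ ^ p
          ∂(torusMeasure d) := by
        refine lintegral_mono fun t => (enorm_sum_rpow_le_of_disjoint hp0 ?_).trans_eq ?_
        · intro n l hnl hn
          have hn' : t ∈ torusSlab i (φ n) := by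
            by_contra hcon
            exact hn (by rw [bumpFun, Set.indicator_of_notMem hcon, mul_zero])
          rw [bumpFun, Set.indicator_of_notMem (disjoint_torusSlab i (hφ.ne hnl) hn'), mul_zero]
        · exact Finset.sum_congr rfl fun n _ => by
            rw [enorm_mul, ENNReal.mul_rpow_of_nonneg _ _ hp0.le]
    _ = ∑ n ∈ Finset.range N, ‖a n‖ₑ ^ p * ENNReal.ofReal κ := by
        have hm : ∀ n, AEMeasurable (fun t => ‖bumpFun i p (φ n) t‖ₑ ^ p) (torusMeasure d) :=
          fun n => ((memLp_bumpFun i p (φ n) 1).aestronglyMeasurable.enorm).pow_const p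
        rw [lintegral_finsetSum' _ fun n _ => (hm n).const_mul _]
        refine Finset.sum_congr rfl fun n _ => ?_
        rw [lintegral_const_mul'' _ (hm n), lintegral_enorm_rpow_bumpFun i p (φ n) hp0, hκm,
          ← ENNReal.ofReal_mul (Real.rpow_nonneg (bumpHeight_pos p _).le _), bumpHeight,
          ← Real.rpow_mul (by positivity), one_div_mul_cancel hp0.ne', Real.rpow_one]
        congr 2
        rw [one_div_pow]
        field_simp
    _ = _ := by rw [← Finset.sum_mul, mul_comm]

lemma torusFourier_sum_apply {d : ℕ} (i : Fin d) {p : ℝ} [Fact (1 < p)] [Fact (p < 2)]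
    (φ : ℕ → ℕ) (a : ℕ → ℂ) (m : Fin d → ℤ) (N : ℕ) :
    torusFourier d p (∑ n ∈ Finset.range N, a n • bumpLp i p (φ n)) m =
      ∑ n ∈ Finset.range N, a n * torusFourierCoeff (bumpFun i p (φ n)) m := by
  induction N with
  | zero => simp only [Finset.range_zero, Finset.sum_empty, map_zero]; rfl
  | succ N ih =>
    rw [Finset.sum_range_succ, Finset.sum_range_succ, map_add, map_smul, ← ih]
    change _ + a N * torusFourierCoeff (bumpLp i p (φ N)) m = _
    rw [bumpLp, torusFourierCoeff_congr (MemLp.coeFn_toLp _)]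

/-- The lower `p`-estimate for the Fourier transform on a subsequence of the test functions. -/
lemma exists_lower_estimate {d : ℕ} (i : Fin d) {p : ℝ} [h1 : Fact (1 < p)] [h2 : Fact (p < 2)]
    {κ : ℝ} (hκ : 0 < κ)
    (hκm : ∀ j, torusMeasure d (torusSlab i j) = ENNReal.ofReal (κ * (1 / 2) ^ j)) :
    ∃ φ : ℕ → ℕ, StrictMono φ ∧ ∃ δ : ℝ, 0 < δ ∧ ∀ (N : ℕ) (a : ℕ → ℂ),
      ENNReal.ofReal δ * ∑ n ∈ Finset.range N, ‖a n‖ₑ ^ p ≤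
        ‖torusFourier d p (∑ n ∈ Finset.range N, a n • bumpLp i p (φ n))‖ₑ ^ p := by
  have hp1 := h1.out
  have hp2 := h2.out
  have hp0 : 0 < p := by linarith
  -- Chosen so that `20 * ε` is the uniform lower bound for the rows, as `le_sum_of_blocks` demands.
  set η : ℝ := (κ / 2) ^ p / 20 with hη
  have hη0 : 0 < η := by positivity
  set ε : ℝ≥0∞ := ENNReal.ofReal η with hε
  have hε0 : 0 < ε := ENNReal.ofReal_pos.2 hη0
  obtain ⟨φ, M, hφ, hM, hhead, htail⟩ := exists_gliding_hump (fun j k => bumpRow i p j k ^ p)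
    (fun j => tsum_bumpRow_ne_top i j) (fun k => tendsto_bumpRow i k) (fun n => ε * (4⁻¹) ^ n)
    (fun n => ENNReal.mul_pos hε0.ne' (by simp))
  have hanti : Antitone fun n : ℕ => ε * (4⁻¹ : ℝ≥0∞) ^ n := fun m n hmn =>
    mul_le_mul' le_rfl (pow_le_pow_right_of_le_one' (by norm_num) hmn)
  obtain ⟨hoff, hdiag⟩ := gliding_hump_blocks
    (U := fun j k => bumpRow i p j k ^ p) (φ := φ) hanti hM hhead htail
  refine ⟨φ, hφ, 5 * η, by positivity, fun N a => ?_⟩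
  set x := ∑ n ∈ Finset.range N, a n • bumpLp i p (φ n) with hx
  set c : (Fin d → ℤ) → ℂ := (torusFourier d p x).1 with hc
  have hnorm : ‖torusFourier d p x‖ₑ = Lorentz.eNorm p.conjExponent p c := by
    rw [← ofReal_norm]; exact LorentzSeq.ofReal_norm_eq _
  rw [hnorm, ENNReal.ofReal_mul (by norm_num), show ENNReal.ofReal 5 = 5 by simp]
  refine le_trans (le_sum_of_blocks (u := fun n k => bumpRow i p (φ n) k) hp1.le hp2.le hM
    ENNReal.ofReal_ne_top hoff (fun n => ?_) (a := fun n => ‖a n‖ₑ) (fun n => enorm_ne_top)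
    (v := fun k => Lorentz.weight p.conjExponent p k * ‖c (Pi.single i (k : ℤ))‖ₑ) ?_)
    (sum_weight_rpow_le_eNorm i c (M N))
  · calc 20 * ε = ENNReal.ofReal ((κ / 2) ^ p) := by
          rw [hε, show (20 : ℝ≥0∞) = ENNReal.ofReal 20 by simp, ← ENNReal.ofReal_mul (by norm_num)]
          congr 1
          rw [hη]; ring
      _ ≤ _ := le_tsum_bumpRow i hκ hκm (φ n)
      _ ≤ _ := hdiag n
      _ ≤ _ := by
          gcongr
          exact mul_le_of_le_one_right' (pow_le_one' (by norm_num) n)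
  · intro n hn k
    set m : Fin d → ℤ := Pi.single i (k : ℤ) with hm
    set w := Lorentz.weight p.conjExponent p k with hw
    have hsum : c m = ∑ n ∈ Finset.range N, a n * torusFourierCoeff (bumpFun i p (φ n)) m :=
      torusFourier_sum_apply i φ a m N
    rw [← Finset.add_sum_erase _ _ hn] at hsum
    have hle : ‖a n * torusFourierCoeff (bumpFun i p (φ n)) m‖ₑ ≤ ‖c m‖ₑ +
        ∑ j ∈ (Finset.range N).erase n, ‖a j * torusFourierCoeff (bumpFun i p (φ j)) m‖ₑ := by
      -- The `n`-th term is `c m` minus the other terms; this is the triangle inequality that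
      -- supplies `hv`.
      rw [← sub_eq_iff_eq_add.2 hsum]
      exact enorm_sub_le.trans (add_le_add le_rfl (enorm_sum_le _ _))
    calc ‖a n‖ₑ * bumpRow i p (φ n) k
        = w * ‖a n * torusFourierCoeff (bumpFun i p (φ n)) m‖ₑ := by
          rw [bumpRow, enorm_mul]; ring
      _ ≤ w * (‖c m‖ₑ +
          ∑ j ∈ (Finset.range N).erase n, ‖a j * torusFourierCoeff (bumpFun i p (φ j)) m‖ₑ) := by
          gcongr
      _ = w * ‖c m‖ₑ + ∑ j ∈ (Finset.range N).erase n, ‖a j‖ₑ * bumpRow i p (φ j) k := by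
          rw [mul_add, Finset.mul_sum]
          congr 1
          refine Finset.sum_congr rfl fun j _ => ?_
          rw [bumpRow, enorm_mul]; ring
      _ = _ := by
          congr 1
          rw [← Finset.add_sum_erase _ _ hn, if_pos rfl, zero_add]
          exact Finset.sum_congr rfl fun j hj => by rw [if_neg (Finset.ne_of_mem_erase hj)]

lemma Finsupp.sum_smul_eq_sum_range {V : Type*} [AddCommGroup V] [Module ℂ V] (l : ℕ →₀ ℂ)
    (f : ℕ → V) : (l.sum fun n a => a • f n) =
      ∑ n ∈ Finset.range (l.support.sup id + 1), l n • f n :=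
  Finsupp.sum_of_support_subset _ (fun _ hn => Finset.mem_range.2
    (Nat.lt_succ_of_le (Finset.le_sup (f := id) hn))) _ fun _ _ => zero_smul _ _

/-- An operator with an upper `p`-estimate on a sequence in the domain and a lower `p`-estimate on
its image is not strictly singular. -/
lemma not_strictlySingular_of_estimates {X Y : Type*} [NormedAddCommGroup X] [NormedSpace ℂ X]
    [NormedAddCommGroup Y] [NormedSpace ℂ Y] (T : X →L[ℂ] Y) {p : ℝ} (hp : 0 < p) (f : ℕ → X)
    {κ δ : ℝ} (hκ : 0 < κ) (hδ : 0 < δ)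
    (hup : ∀ (N : ℕ) (a : ℕ → ℂ), ‖∑ n ∈ Finset.range N, a n • f n‖ₑ ^ p ≤
      ENNReal.ofReal κ * ∑ n ∈ Finset.range N, ‖a n‖ₑ ^ p)
    (hlow : ∀ (N : ℕ) (a : ℕ → ℂ), ENNReal.ofReal δ * ∑ n ∈ Finset.range N, ‖a n‖ₑ ^ p ≤
      ‖T (∑ n ∈ Finset.range N, a n • f n)‖ₑ ^ p) : ¬ StrictlySingular T := by
  -- The lower estimate forces the coefficients of a vanishing combination to be zero.
  have hli : LinearIndependent ℂ f := by
    rw [linearIndependent_iff]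
    intro l hl
    rw [Finsupp.linearCombination_apply, Finsupp.sum_smul_eq_sum_range] at hl
    have h := hlow (l.support.sup id + 1) l
    rw [hl, map_zero, enorm_zero, ENNReal.zero_rpow_of_pos hp] at h
    have h' := (mul_eq_zero.1 (le_antisymm h bot_le)).resolve_left
      (ENNReal.ofReal_pos.2 hδ).ne'
    rw [Finset.sum_eq_zero_iff] at h'
    ext n
    by_cases hn : n ∈ l.support
    · have := h' n (Finset.mem_range.2 (Nat.lt_succ_of_le (Finset.le_sup (f := id) hn)))
      simpa [hp, hp.not_gt] using this
    · simpa using hn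
  -- Eliminating `∑ ‖a n‖ ^ p` between the two estimates gives `δ ‖x‖^p ≤ κ ‖T x‖^p` on the span;
  -- the bound passes to the closure by continuity.
  set c : ℝ := (δ / κ) ^ (1 / p) with hc
  have hc0 : 0 < c := by positivity
  have hbound : ∀ x ∈ Submodule.span ℂ (Set.range f), c * ‖x‖ ≤ ‖T x‖ := by
    intro x hx
    obtain ⟨l, rfl⟩ := Finsupp.mem_span_range_iff_exists_finsupp.1 hx
    rw [Finsupp.sum_smul_eq_sum_range]
    have h1 := hup (l.support.sup id + 1) l
    have h2 := hlow (l.support.sup id + 1) l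
    set x := ∑ n ∈ Finset.range (l.support.sup id + 1), l n • f n
    have h3 : ENNReal.ofReal δ * ‖x‖ₑ ^ p ≤ ENNReal.ofReal κ * ‖T x‖ₑ ^ p := by
      calc _ ≤ ENNReal.ofReal δ * (ENNReal.ofReal κ * _) := mul_le_mul' le_rfl h1
        _ = ENNReal.ofReal κ * (ENNReal.ofReal δ * _) := mul_left_comm _ _ _
        _ ≤ _ := mul_le_mul' le_rfl h2
    rw [← ofReal_norm, ← ofReal_norm, ENNReal.ofReal_rpow_of_nonneg (norm_nonneg _) hp.le,
      ENNReal.ofReal_rpow_of_nonneg (norm_nonneg _) hp.le, ← ENNReal.ofReal_mul hδ.le,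
      ← ENNReal.ofReal_mul hκ.le, ENNReal.ofReal_le_ofReal_iff (by positivity)] at h3
    rw [← Real.rpow_le_rpow_iff (by positivity) (norm_nonneg _) hp,
      Real.mul_rpow hc0.le (norm_nonneg _), hc, ← Real.rpow_mul (by positivity),
      one_div_mul_cancel hp.ne', Real.rpow_one, div_mul_eq_mul_div, div_le_iff₀ hκ]
    linarith
  intro hT
  set E := (Submodule.span ℂ (Set.range f)).topologicalClosure with hE
  have hEbound : ∀ x ∈ E, c * ‖x‖ ≤ ‖T x‖ := fun x hx =>
    closure_minimal (s := (Submodule.span ℂ (Set.range f) : Set X))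
      (t := {x | c * ‖x‖ ≤ ‖T x‖}) hbound
      (isClosed_le (by fun_prop) (by fun_prop)) hx
  have hinf : ¬ FiniteDimensional ℂ E := by
    intro hfd
    have hmem : ∀ n, f n ∈ E := fun n =>
      Submodule.le_topologicalClosure _ (Submodule.subset_span ⟨n, rfl⟩)
    have hli' : LinearIndependent ℂ fun n => (⟨f n, hmem n⟩ : E) :=
      LinearIndependent.of_comp E.subtype hli
    exact not_finite_iff_infinite.2 (inferInstance : Infinite ℕ) hli'.finite
  obtain ⟨x, hxE, hx1, hxT⟩ := hT E (Submodule.isClosed_topologicalClosure _) hinf (c / 2)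
    (by positivity)
  have := hEbound x hxE
  rw [hx1] at this
  linarith

end

theorem theorem5p1 (d : ℕ) (hd : 0 < d) (p : ℝ) [Fact (1 < p)] [Fact (p < 2)] :
    ∃ T : Lp ℂ (ENNReal.ofReal p) (torusMeasure d) →L[ℂ]
        LorentzSeq (Fin d → ℤ) p.conjExponent p,
      (∀ (f : Lp ℂ (ENNReal.ofReal p) (torusMeasure d)) (m : Fin d → ℤ),
        T f m = torusFourierCoeff f m) ∧
      ¬ StrictlySingular T := by
  -- Positivity of `d` supplies the coordinate along which the slabs are cut.
  obtain ⟨κ, hκ, hκm⟩ := exists_torusMeasure_torusSlab (⟨0, hd⟩ : Fin d)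
  obtain ⟨φ, hφ, δ, hδ, hlow⟩ := exists_lower_estimate (p := p) (⟨0, hd⟩ : Fin d) hκ hκm
  exact ⟨torusFourier d p, torusFourier_apply, not_strictlySingular_of_estimates _
    (zero_lt_one.trans (Fact.out : 1 < p)) _ hκ hδ
    (enorm_sum_bumpLp_rpow_le _ hκ hκm hφ.injective) hlow⟩
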